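/- Let $\mathbb{R}^+=(0,\infty)$, let $f\in C^2(\mathbb{R})$, let $\Omega\subseteq\mathbb{R}^+\times\mathbb{R}$ be open and let $u\in C(\Omega)$. A \emph{Lagrangian parameterization} associated with $u$ is a continuous function $\chi:\mathbb{R}^+\times\mathbb{R}\to\mathbb{R}$ such that for every $t>0$ the map $y\mapsto\chi(t,y)$ is nondecreasing and onto $\mathbb{R}$, and for every $y\in\mathbb{R}$ the curve $t\mapsto\chi(t,y)$ satisfies $\partial_t\chi(t,y)=f'(u(t,\chi(t,y)))$ at every $t$ in the open set $T_y=\{t>0:(t,\chi(t,y))\in\Omega\}$. The function $u$ is a \emph{continuous Lagrangian solution} of \[\partial_t u+\partial_x f(u)=g\] in $\Omega$, with parameterization $\chi$ and Lagrangian source the bounded Borel function $g_L:\Omega\to\mathbb{R}$, if for every $y\in\mathbb{R}$ \[\frac{d}{dt}\,u(t,\chi(t,y))=g_L(t,\chi(t,y))\qquad\text{in the sense of distributions on }T_y .\] Suppose that $u$ is such a solution and that $|g_L(t,\chi(t,y))|\le G$ for every $y\in\mathbb{R}$ and almost every $t\in T_y$. Then there is $g_E\in L^\infty(\Omega)$ with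 $|g_E|\le G$ almost everywhere in $\Omega$ such that $u$ is a continuous distributional (Eulerian) solution with source $g_E$, that is, \[\partial_t u+\partial_x f(u)=g_E\qquad\text{in the sense of distributions on }\Omega,\] and, with the same $g_E$, $u$ dissipates no entropy: for all $\eta,q\in C^1(\mathbb{R})$ with $q'=\eta' f'$, \[\partial_t\,\eta(u)+\partial_x\,q(u)=\eta'(u)\,g_E\qquad\text{in the sense of distributions on }\Omega .\] -/

import Mathlib

open MeasureTheory Set
open scoped ContDiff

/-- The open half plane `ℝ⁺ × ℝ` of points `(t, x)` with `t > 0`. -/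
def halfPlane : Set (ℝ × ℝ) := Ioi 0 ×ˢ univ

/-- The set of times `i_γ⁻¹(Ω)` at which the graph of the curve `γ` lies in `Ω`. -/
def curveTimes (Ω : Set (ℝ × ℝ)) (γ : ℝ → ℝ) : Set ℝ := {t | (t, γ t) ∈ Ω}

/-- `φ ∈ C_c^∞(U)`, as a function on the whole space vanishing off a compact subset of `U`. -/
structure IsTestFunction {E : Type*} [NormedAddCommGroup E] [NormedSpace ℝ E]
    (U : Set E) (φ : E → ℝ) : Prop where
  smooth : ContDiff ℝ ∞ φ
  compact : HasCompactSupport φ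
  supp : tsupport φ ⊆ U

/-- `∂ₜ a + ∂ₓ b = h` in the sense of distributions on `Ω`. -/
def DistribBalance (Ω : Set (ℝ × ℝ)) (a b h : ℝ × ℝ → ℝ) : Prop :=
  ∀ φ : ℝ × ℝ → ℝ, IsTestFunction Ω φ →
    -∫ p in Ω, (fderiv ℝ φ p (1, 0) * a p + fderiv ℝ φ p (0, 1) * b p) = ∫ p in Ω, φ p * h p

/-- `v' = h` in the sense of distributions on the set `T` of times. -/
def DistribDeriv (T : Set ℝ) (v h : ℝ → ℝ) : Prop :=
  ∀ φ : ℝ → ℝ, IsTestFunction T φ →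
    -∫ t in T, deriv φ t * v t = ∫ t in T, φ t * h t

/-- `γ` is a characteristic curve of `u` in `Ω`: it solves `γ' = f'(u(t, γ))` as long as its graph
is in `Ω`. The right-hand side is continuous along `γ`, so an absolutely continuous solution is a
classical one. -/
def IsCharacteristic (f : ℝ → ℝ) (Ω : Set (ℝ × ℝ)) (u : ℝ × ℝ → ℝ) (γ : ℝ → ℝ) : Prop :=
  ∀ t ∈ curveTimes Ω γ, HasDerivAt γ (deriv f (u (t, γ t))) t

/-- Lagrangian parameterization `χ(t, y)`, `t > 0`, `y ∈ ℝ`, associated with `u ∈ C(Ω)`. -/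
structure IsLagrangianParam (f : ℝ → ℝ) (Ω : Set (ℝ × ℝ)) (u : ℝ × ℝ → ℝ)
    (χ : ℝ → ℝ → ℝ) : Prop where
  continuousOn : ContinuousOn (fun p : ℝ × ℝ => χ p.1 p.2) halfPlane
  surjective : ∀ t, 0 < t → Function.Surjective (χ t)
  monotone : ∀ t, 0 < t → Monotone (χ t)
  characteristic : ∀ y, IsCharacteristic f Ω u (fun t => χ t y)

/-- `u` is a continuous Lagrangian solution in `Ω` with Lagrangian parameterization `χ` and
Lagrangian source the class of the bounded Borel function `g`. -/
structure IsLagrangianSolution (f : ℝ → ℝ) (Ω : Set (ℝ × ℝ)) (u : ℝ × ℝ → ℝ)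
    (χ : ℝ → ℝ → ℝ) (g : ℝ × ℝ → ℝ) : Prop where
  continuousOn : ContinuousOn u Ω
  param : IsLagrangianParam f Ω u χ
  source_borel : Measurable (Ω.domRestrict g)
  source_bounded : ∃ M : ℝ, ∀ p ∈ Ω, |g p| ≤ M
  deriv_eq : ∀ y, DistribDeriv (curveTimes Ω fun t => χ t y)
    (fun t => u (t, χ t y)) (fun t => g (t, χ t y))

/-- The Lagrangian source `g` is bounded by `G`: functions that agree a.e. along every curve of `χ`
are identified, so the bound is required a.e. along every such curve. -/
def LagrangianSourceBound (Ω : Set (ℝ × ℝ)) (χ : ℝ → ℝ → ℝ) (g : ℝ × ℝ → ℝ) (G : ℝ) : Prop :=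
  ∀ y, ∀ᵐ t ∂(volume.restrict (curveTimes Ω fun t => χ t y)), |g (t, χ t y)| ≤ G

/-- `u` is a continuous distributional (Eulerian) solution of `∂ₜ u + ∂ₓ f(u) = g` in `Ω`, with
source `g ∈ L^∞(Ω)`. -/
structure IsEulerianSolution (f : ℝ → ℝ) (Ω : Set (ℝ × ℝ)) (u : ℝ × ℝ → ℝ)
    (g : ℝ × ℝ → ℝ) : Prop where
  continuousOn : ContinuousOn u Ω
  source_memLp : MemLp g ⊤ (volume.restrict Ω)
  balance : DistribBalance Ω u (fun p => f (u p)) g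

/-- Entropy-entropy flux pair `η, q ∈ C¹(ℝ)`, `q' = η' f'`. -/
structure IsEntropyPair (f η q : ℝ → ℝ) : Prop where
  entropy_smooth : ContDiff ℝ 1 η
  flux_smooth : ContDiff ℝ 1 q
  deriv_flux : ∀ z, deriv q z = deriv η z * deriv f z

/-!
Between two characteristics `ξ₀ ≤ ξ₁` the mass `∫ φ dx` of a test function has time derivative
`∫ ∂ₜφ dx + [φ f'(u)]`, the bracket being taken between `ξ₀` and `ξ₁`. Cut a strip bounded by
characteristics into cells, weight the cells by values that are `G`-Lipschitz in time, and sum: the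
volume terms and, after summation by parts, the jumps approximate `∫ ∂ₜφ η(u) + ∂ₓφ q(u)`, and the
error made in time is at most `sup |η'| · G · ‖φ‖₁`.

The difficulty is that `u` may have unbounded variation in `x`, so the values `U j` of `u` on the
cells cannot be summed by parts directly. They are replaced by the chain `M 0 = U 0`,
`M (j + 1) = median (M j) (U (j + 1)) V`, with `V` the last of the `U j`. Its variation is
`|U 0 - V|`, it is `1`-Lipschitz in the data, hence still `G`-Lipschitz in time, and each of its
steps stays between `U j` and `U (j + 1)`, where `f'` is almost the speed of the characteristic.

The resulting local bound is globalized by a partition of unity. For `η = id` duality turns it into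
a source `gE` with `|gE| ≤ G`. For a general entropy, compare `η` near a point `p` with the linear
entropy of slope `η'(u p)`: the difference has small derivative, so the entropy defect is at most
`2 ε G ‖φ‖₁` for every `ε > 0`.
-/

open scoped NNReal Topology

lemma le_of_forall_pos_le_add_mul {x y z : ℝ} (h : ∀ ε > 0, x ≤ y + ε * z) : x ≤ y := by
  have hlim : Filter.Tendsto (fun ε : ℝ => y + ε * z) (𝓝[>] 0) (𝓝 y) :=
    tendsto_nhdsWithin_of_tendsto_nhds <| Continuous.tendsto' (by fun_prop) _ _ (by simp)
  exact ge_of_tendsto hlim (eventually_mem_nhdsWithin.mono h)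

lemma abs_integral_deriv_mul_le {a b : ℝ} (hab : a ≤ b) {P P' H : ℝ → ℝ} {K : ℝ≥0}
    (hP : ∀ t ∈ Icc a b, HasDerivAt P (P' t) t) (hP' : ContinuousOn P' (Icc a b))
    (hPa : P a = 0) (hPb : P b = 0) (hH : LipschitzOnWith K H (Icc a b)) :
    |∫ t in a..b, P' t * H t| ≤ K * ∫ t in a..b, |P t| := by
  rw [← uIcc_of_le hab] at hP hP' hH
  have hPc : ContinuousOn P (uIcc a b) := HasDerivAt.continuousOn hP
  obtain ⟨C, hC⟩ := isCompact_uIcc.exists_bound_of_continuousOn hP'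
  have hPlip : LipschitzOnWith C.toNNReal P (uIcc a b) :=
    (convex_uIcc a b).lipschitzOnWith_of_nnnorm_hasDerivWithin_le
      (fun t ht => (hP t ht).hasDerivWithinAt) fun t ht => by
        simpa [← NNReal.coe_le_coe] using Or.inl (hC t ht)
  have hderiv : ∫ t in a..b, P' t * H t = ∫ t in a..b, deriv P t * H t :=
    intervalIntegral.integral_congr fun t ht => by simp only [(hP t ht).deriv]
  have hibp : ∫ t in a..b, P t * deriv H t = -∫ t in a..b, deriv P t * H t := by
    rw [hPlip.absolutelyContinuousOnInterval.integral_mul_deriv_eq_deriv_mul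
      hH.absolutelyContinuousOnInterval, hPa, hPb]
    ring
  have hH' : ∀ᵐ t, t ∈ Ioc a b → ‖P t * deriv H t‖ ≤ K * |P t| := by
    filter_upwards [Measure.ae_ne volume b] with t htb ht
    have : ‖deriv H t‖ ≤ K := norm_deriv_le_of_lipschitzOn
      (Icc_mem_nhds ht.1 (ht.2.lt_of_ne htb)) (uIcc_of_le hab ▸ hH)
    rw [norm_mul, mul_comm]
    exact mul_le_mul_of_nonneg_right this (norm_nonneg _)
  rw [hderiv, ← abs_neg, ← hibp, ← intervalIntegral.integral_const_mul]
  exact intervalIntegral.norm_integral_le_of_norm_le hab hH'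
    (hPc.abs.intervalIntegrable.const_mul _)

/-! ### Median chains -/

section MedianChain

variable {α : Type*} [LinearOrder α]

/-- The median of three elements of a linear order: the point of `uIcc a b` closest to `c`. -/
def median (a b c : α) : α := max (min a b) (min (max a b) c)

/-- The chain that starts at `U 0` and, at each step, moves towards the target `V` as far as the
hull of its current position and the next value of `U` allows. -/
def medianChain (V : α) (U : ℕ → α) : ℕ → α
  | 0 => U 0
  | j + 1 => median (medianChain V U j) (U (j + 1)) V

variable {V : α} {U : ℕ → α} {j : ℕ}

lemma median_mem_uIcc (a b c : α) : median a b c ∈ uIcc a b :=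
  ⟨le_max_left _ _, max_le min_le_max (min_le_left _ _)⟩

lemma medianChain_mem {J : Set α} [hJ : J.OrdConnected] (h : ∀ i ≤ j, U i ∈ J) :
    medianChain V U j ∈ J := by
  induction j with
  | zero => exact h 0 le_rfl
  | succ j ih =>
    exact hJ.uIcc_subset (ih fun i hi => h i (by lia)) (h _ le_rfl) (median_mem_uIcc _ _ _)

variable (V U j) in
lemma medianChain_mem_uIcc : medianChain V U j ∈ uIcc (U j) V := by
  cases j with
  | zero => exact left_mem_uIcc
  | succ j =>
    simp only [medianChain, median, mem_uIcc]
    grind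

lemma medianChain_eq_last (U : ℕ → α) (n : ℕ) : medianChain (U n) U n = U n := by
  simpa using medianChain_mem_uIcc (U n) U n

lemma uIcc_medianChain_subset (h : medianChain V U (j + 1) ≠ medianChain V U j) :
    uIcc (medianChain V U j) (medianChain V U (j + 1)) ⊆ uIcc (U j) (U (j + 1)) := by
  have hj := medianChain_mem_uIcc V U j
  refine uIcc_subset_uIcc ?_ ?_ <;>
  · simp only [medianChain, median, mem_uIcc] at *
    grind

end MedianChain

section MedianChainMetric

variable {α : Type*} [AddCommGroup α] [LinearOrder α] [IsOrderedAddMonoid α]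
  {V V' r : α} {U U' : ℕ → α} {j : ℕ}

lemma abs_median_sub_median_le {a b c a' b' c' : α} (ha : |a - a'| ≤ r) (hb : |b - b'| ≤ r)
    (hc : |c - c'| ≤ r) : |median a b c - median a' b' c'| ≤ r := by
  have hmin := (abs_min_sub_min_le_max a b a' b').trans (max_le ha hb)
  have hmax := (abs_max_sub_max_le_max a b a' b').trans (max_le ha hb)
  exact (abs_max_sub_max_le_max _ _ _ _).trans <|
    max_le hmin ((abs_min_sub_min_le_max _ _ _ _).trans (max_le hmax hc))

lemma abs_medianChain_sub_medianChain_le (hV : |V - V'| ≤ r) (hU : ∀ i ≤ j, |U i - U' i| ≤ r) :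
    |medianChain V U j - medianChain V' U' j| ≤ r := by
  induction j with
  | zero => exact hU 0 le_rfl
  | succ j ih =>
    exact abs_median_sub_median_le (ih fun i hi => hU i (by lia)) (hU _ le_rfl) hV

variable (V U j) in
lemma abs_medianChain_succ_sub :
    |medianChain V U (j + 1) - medianChain V U j|
      = |medianChain V U j - V| - |medianChain V U (j + 1) - V| := by
  simp only [medianChain, median]
  grind

variable (V U) in
lemma sum_abs_medianChain_le (n : ℕ) :
    ∑ j ∈ Finset.range n, |medianChain V U (j + 1) - medianChain V U j| ≤ |U 0 - V| := by
  simp only [abs_medianChain_succ_sub]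
  rw [Finset.sum_range_sub' fun j => |medianChain V U j - V|]
  exact sub_le_self _ (abs_nonneg _)

end MedianChainMetric

/-! ### Integrals over moving intervals -/

section MovingInterval

variable {E : Type*} [NormedAddCommGroup E] [NormedSpace ℝ E] {ψ φ : ℝ × ℝ → E} {α β : ℝ → ℝ}

lemma continuous_integral_moving (hψ : Continuous ψ) (hα : Continuous α) (hβ : Continuous β) :
    Continuous fun t => ∫ x in α t..β t, ψ (t, x) := by
  have from_zero {γ : ℝ → ℝ} (hγ : Continuous γ) : Continuous fun t => ∫ x in 0..γ t, ψ (t, x) :=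
    intervalIntegral.continuous_parametric_intervalIntegral_of_continuous
      (f := fun t x => ψ (t, x)) hψ hγ
  have hi (t c : ℝ) : IntervalIntegrable (fun x => ψ (t, x)) volume 0 c :=
    (hψ.comp (by fun_prop : Continuous fun x : ℝ => (t, x))).intervalIntegrable _ _
  exact ((from_zero hβ).sub (from_zero hα)).congr fun t =>
    intervalIntegral.integral_interval_sub_left (hi t _) (hi t _)

lemma hasDerivAt_integral_param (hφ : ContDiff ℝ 1 φ) (a b t : ℝ) :
    HasDerivAt (fun s => ∫ x in a..b, φ (s, x)) (∫ x in a..b, fderiv ℝ φ (t, x) (1, 0)) t := by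
  have hsec (s : ℝ) : Continuous fun x => φ (s, x) := hφ.continuous.comp (by fun_prop)
  have hdφ : Continuous fun p => fderiv ℝ φ p (1, 0) :=
    (hφ.continuous_fderiv one_ne_zero).clm_apply continuous_const
  obtain ⟨C, hC⟩ := ((isCompact_closedBall t 1).prod
    (isCompact_uIcc (a := a) (b := b))).exists_bound_of_continuousOn hdφ.continuousOn
  refine (intervalIntegral.hasDerivAt_integral_of_dominated_loc_of_deriv_le
    (F := fun s x => φ (s, x)) (F' := fun s x => fderiv ℝ φ (s, x) (1, 0))
    (bound := fun _ => C) (Metric.closedBall_mem_nhds t one_pos)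
    (.of_forall fun s => (hsec s).aestronglyMeasurable)
    ((hsec _).intervalIntegrable _ _)
    (hdφ.comp (by fun_prop : Continuous fun x : ℝ => (t, x))).aestronglyMeasurable
    (ae_of_all _ fun x hx s hs => hC (s, x) ⟨hs, uIoc_subset_uIcc hx⟩)
    intervalIntegrable_const (ae_of_all _ fun x _ s _ => ?_)).2
  exact (hφ.differentiable one_ne_zero (s, x)).hasFDerivAt.comp_hasDerivAt s
    ((hasDerivAt_id s).prodMk (hasDerivAt_const s x))

variable [CompleteSpace E] {α' β' t : ℝ}

lemma hasDerivAt_integral_moving_right (hφ : ContDiff ℝ 1 φ) (a : ℝ) (hβ : HasDerivAt β β' t) :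
    HasDerivAt (fun s => ∫ x in a..β s, φ (s, x))
      ((∫ x in a..β t, fderiv ℝ φ (t, x) (1, 0)) + β' • φ (t, β t)) t := by
  have hφc : Continuous φ := hφ.continuous
  have hdφ : Continuous fun p => fderiv ℝ φ p (1, 0) :=
    (hφ.continuous_fderiv one_ne_zero).clm_apply continuous_const
  have hright (v : ℝ × ℝ) : HasDerivAt (fun c => ∫ x in a..c, φ (v.1, x)) (φ v) v.2 :=
    (hφc.comp (by fun_prop : Continuous fun x : ℝ => (v.1, x))).integral_hasStrictDerivAt _ _
      |>.hasDerivAt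
  have hcont : Continuous fun v : ℝ × ℝ => ∫ x in a..v.2, fderiv ℝ φ (v.1, x) (1, 0) :=
    intervalIntegral.continuous_parametric_intervalIntegral_of_continuous
      (f := fun (v : ℝ × ℝ) x => fderiv ℝ φ (v.1, x) (1, 0))
      (hdφ.comp (by fun_prop : Continuous fun z : (ℝ × ℝ) × ℝ => (z.1.1, z.2))) continuous_snd
  have hspan := (ContinuousLinearMap.toSpanSingletonCLE (𝕜 := ℝ) (E := E)).continuous
  have hjoint := hasStrictFDerivAt_uncurry_coprod (𝕜 := ℝ) (u := (t, β t))
    (f := fun s c => ∫ x in a..c, φ (s, x))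
    (f₁ := fun s c => .toSpanSingleton ℝ (∫ x in a..c, fderiv ℝ φ (s, x) (1, 0)))
    (f₂ := fun s c => .toSpanSingleton ℝ (φ (s, c)))
    (.of_forall fun v => (hasDerivAt_integral_param hφ a v.2 v.1).hasFDerivAt)
    (.of_forall fun v => (hright v).hasFDerivAt)
    (hspan.comp hcont).continuousAt (hspan.comp hφc).continuousAt
  refine (hjoint.hasFDerivAt.comp_hasDerivAt t ((hasDerivAt_id t).prodMk hβ)).congr_deriv ?_
  simp [Function.HasUncurry.uncurry]

lemma hasDerivAt_integral_moving (hφ : ContDiff ℝ 1 φ) (hα : HasDerivAt α α' t)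
    (hβ : HasDerivAt β β' t) :
    HasDerivAt (fun s => ∫ x in α s..β s, φ (s, x))
      ((∫ x in α t..β t, fderiv ℝ φ (t, x) (1, 0)) + (β' • φ (t, β t) - α' • φ (t, α t))) t := by
  have hφi (s c : ℝ) : IntervalIntegrable (fun x => φ (s, x)) volume 0 c :=
    (hφ.continuous.comp (by fun_prop : Continuous fun x : ℝ => (s, x))).intervalIntegrable _ _
  have hdφi (c : ℝ) : IntervalIntegrable (fun x => fderiv ℝ φ (t, x) (1, 0)) volume 0 c :=
    (((hφ.continuous_fderiv one_ne_zero).clm_apply continuous_const).comp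
      (by fun_prop : Continuous fun x : ℝ => (t, x))).intervalIntegrable _ _
  refine (((hasDerivAt_integral_moving_right hφ 0 hβ).sub
    (hasDerivAt_integral_moving_right hφ 0 hα)).congr_deriv ?_).congr_of_eventuallyEq
    (.of_forall fun s => (intervalIntegral.integral_interval_sub_left (hφi s _) (hφi s _)).symm)
  rw [← intervalIntegral.integral_interval_sub_left (hdφi (β t)) (hdφi (α t))]
  abel

end MovingInterval

lemma exists_partition_dist_le {β : Type*} [PseudoMetricSpace β] {y₀ y₁ δ : ℝ} (hy : y₀ ≤ y₁)
    (hδ : 0 < δ) {h : ℝ → β} (hh : ContinuousOn h (Icc y₀ y₁)) :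
    ∃ (n : ℕ) (z : ℕ → ℝ), Monotone z ∧ z 0 = y₀ ∧ z n = y₁ ∧ (∀ j, z j ∈ Icc y₀ y₁) ∧
      ∀ j, ∀ y ∈ Icc (z j) (z (j + 1)), ∀ y' ∈ Icc (z j) (z (j + 1)), dist (h y) (h y') ≤ δ := by
  have hh' : Continuous ((Icc y₀ y₁).domRestrict h) := hh.domRestrict
  obtain ⟨z, hz₀, hz, ⟨n, hn⟩, hball⟩ := exists_monotone_Icc_subset_open_cover_Icc hy
    (fun i : Icc y₀ y₁ => (Metric.isOpen_ball (x := h i) (ε := δ / 2)).preimage hh')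
    fun i _ => mem_iUnion.2 ⟨i, Metric.mem_ball_self (half_pos hδ)⟩
  refine ⟨n, fun j => z j, hz, hz₀, hn n le_rfl, fun j => (z j).2, fun j y hyj y' hyj' => ?_⟩
  obtain ⟨i, hi⟩ := hball j
  have near {y : ℝ} (hyj : y ∈ Icc (z j : ℝ) (z (j + 1))) : dist (h y) (h i) < δ / 2 :=
    hi (a := ⟨y, Icc_subset_Icc (z j).2.1 (z (j + 1)).2.2 hyj⟩) hyj
  linarith [dist_triangle_right (h y) (h y') (h i), near hyj, near hyj']

lemma exists_partition_forall_dist_le {X β : Type*} [TopologicalSpace X] [PseudoMetricSpace β]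
    {K : Set X} (hK : IsCompact K) {y₀ y₁ δ : ℝ} (hy : y₀ ≤ y₁) (hδ : 0 < δ) {W : X × ℝ → β}
    (hW : Continuous W) :
    ∃ (n : ℕ) (z : ℕ → ℝ), Monotone z ∧ z 0 = y₀ ∧ z n = y₁ ∧ (∀ j, z j ∈ Icc y₀ y₁) ∧
      ∀ j, ∀ y ∈ Icc (z j) (z (j + 1)), ∀ y' ∈ Icc (z j) (z (j + 1)), ∀ t ∈ K,
        dist (W (t, y)) (W (t, y')) ≤ δ := by
  have := isCompact_iff_compactSpace.1 hK
  let h : C(ℝ, C(K, β)) := ContinuousMap.curry ⟨fun p => W (p.2, p.1), by fun_prop⟩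
  obtain ⟨n, z, hz, hz₀, hzn, hmem, hosc⟩ :=
    exists_partition_dist_le hy hδ h.continuous.continuousOn
  exact ⟨n, z, hz, hz₀, hzn, hmem, fun j y hy y' hy' t ht =>
    ((h y).dist_apply_le_dist ⟨t, ht⟩).trans (hosc j y hy y' hy')⟩

/-! ### Balance of a time slice -/

/-- The flux of `φ • (η(u), q(u))` relative to a characteristic, which moves at speed `f'(u)`. -/
noncomputable def relFlux (f η q : ℝ → ℝ) (u φ : ℝ × ℝ → ℝ) (p : ℝ × ℝ) : ℝ :=
  φ p * (η (u p) * deriv f (u p) - q (u p))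

/-- The integral over `x₀ ≤ x ≤ x₁`, at time `t`, of the density `φ_t η(u) + φ_x q(u)` of the weak
entropy balance, plus the flux through the two ends when these follow characteristics. For `η = 1`
and `q = 0` it is the time derivative of the mass of `φ` between two characteristics. -/
noncomputable def sliceBalance (f η q : ℝ → ℝ) (u φ : ℝ × ℝ → ℝ) (t x₀ x₁ : ℝ) : ℝ :=
  (∫ x in x₀..x₁, fderiv ℝ φ (t, x) (η (u (t, x)), q (u (t, x)))) +
    (relFlux f η q u φ (t, x₁) - relFlux f η q u φ (t, x₀))

section SliceBalance

variable {f η q : ℝ → ℝ} {u φ : ℝ × ℝ → ℝ} {t : ℝ}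

lemma continuous_relFlux (hf : ContDiff ℝ 1 f) (hη : Continuous η) (hq : Continuous q)
    (hu : Continuous u) (hφ : Continuous φ) : Continuous (relFlux f η q u φ) :=
  hφ.mul (((hη.comp hu).mul ((hf.continuous_deriv le_rfl).comp hu)).sub (hq.comp hu))

lemma continuous_fderiv_apply_pair (hη : Continuous η) (hq : Continuous q) (hu : Continuous u)
    (hφ : ContDiff ℝ 1 φ) : Continuous fun p => fderiv ℝ φ p (η (u p), q (u p)) :=
  (hφ.continuous_fderiv one_ne_zero).clm_apply ((hη.comp hu).prodMk (hq.comp hu))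

lemma intervalIntegrable_fderiv_apply_pair (hη : Continuous η) (hq : Continuous q)
    (hu : Continuous u) (hφ : ContDiff ℝ 1 φ) (x₀ x₁ : ℝ) :
    IntervalIntegrable (fun x => fderiv ℝ φ (t, x) (η (u (t, x)), q (u (t, x)))) volume x₀ x₁ :=
  ((continuous_fderiv_apply_pair hη hq hu hφ).comp
    (by fun_prop : Continuous fun x : ℝ => (t, x))).intervalIntegrable _ _

lemma continuous_sliceBalance (hf : ContDiff ℝ 1 f) (hη : Continuous η) (hq : Continuous q)
    (hu : Continuous u) (hφ : ContDiff ℝ 1 φ) {α β : ℝ → ℝ} (hα : Continuous α)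
    (hβ : Continuous β) : Continuous fun t => sliceBalance f η q u φ t (α t) (β t) := by
  have hflux := continuous_relFlux hf hη hq hu hφ.continuous
  exact (continuous_integral_moving (continuous_fderiv_apply_pair hη hq hu hφ) hα hβ).add
    ((hflux.comp (by fun_prop : Continuous fun t => (t, β t))).sub
      (hflux.comp (by fun_prop : Continuous fun t => (t, α t))))

lemma sum_sliceBalance (hη : Continuous η) (hq : Continuous q) (hu : Continuous u)
    (hφ : ContDiff ℝ 1 φ) (X : ℕ → ℝ) (n : ℕ) :
    ∑ j ∈ Finset.range n, sliceBalance f η q u φ t (X j) (X (j + 1))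
      = sliceBalance f η q u φ t (X 0) (X n) := by
  simp only [sliceBalance, Finset.sum_add_distrib]
  rw [Finset.sum_range_sub fun j => relFlux f η q u φ (t, X j),
    intervalIntegral.sum_integral_adjacent_intervals fun j _ =>
      intervalIntegrable_fderiv_apply_pair hη hq hu hφ _ _]

lemma hasDerivAt_integral_between_characteristics (hφ : ContDiff ℝ 1 φ) {α β : ℝ → ℝ}
    (hα : HasDerivAt α (deriv f (u (t, α t))) t) (hβ : HasDerivAt β (deriv f (u (t, β t))) t) :
    HasDerivAt (fun s => ∫ x in α s..β s, φ (s, x)) (sliceBalance f 1 0 u φ t (α t) (β t)) t := by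
  refine (hasDerivAt_integral_moving hφ hα hβ).congr_deriv ?_
  simp [sliceBalance, relFlux, mul_comm]

lemma integral_fderiv_apply_const (hφ : ContDiff ℝ 1 φ) (x₀ x₁ b : ℝ) :
    ∫ x in x₀..x₁, fderiv ℝ φ (t, x) (0, b) = b * (φ (t, x₁) - φ (t, x₀)) := by
  have hderiv (x : ℝ) :
      HasDerivAt (fun x => b * φ (t, x)) (fderiv ℝ φ (t, x) (0, b)) x := by
    have := (hφ.differentiable one_ne_zero (t, x)).hasFDerivAt.comp_hasDerivAt x
      ((hasDerivAt_const x t).prodMk (hasDerivAt_id x))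
    refine (this.const_mul b).congr_deriv ?_
    rw [← smul_eq_mul, ← map_smul]
    simp
  rw [intervalIntegral.integral_eq_sub_of_hasDerivAt (fun x _ => hderiv x)
    ((((hφ.continuous_fderiv one_ne_zero).clm_apply continuous_const).comp
      (by fun_prop : Continuous fun x : ℝ => (t, x))).intervalIntegrable _ _)]
  ring

lemma sliceBalance_one_zero_mul (hφ : ContDiff ℝ 1 φ) (x₀ x₁ a b : ℝ) :
    sliceBalance f 1 0 u φ t x₀ x₁ * a = (∫ x in x₀..x₁, fderiv ℝ φ (t, x) (a, b)) +
      (φ (t, x₁) * (a * deriv f (u (t, x₁)) - b) -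
        φ (t, x₀) * (a * deriv f (u (t, x₀)) - b)) := by
  have hi (a b : ℝ) : IntervalIntegrable (fun x => fderiv ℝ φ (t, x) (a, b)) volume x₀ x₁ :=
    intervalIntegrable_fderiv_apply_pair continuous_const continuous_const continuous_const hφ _ _
      (η := fun _ => a) (q := fun _ => b) (u := 0)
  have hsplit (x : ℝ) : fderiv ℝ φ (t, x) (a, b)
      = fderiv ℝ φ (t, x) (1, 0) * a + fderiv ℝ φ (t, x) (0, b) := by
    rw [mul_comm, ← smul_eq_mul, ← map_smul, ← map_add]
    simp
  simp only [sliceBalance, relFlux, Pi.one_apply, Pi.zero_apply, hsplit]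
  rw [intervalIntegral.integral_add ((hi 1 0).mul_const a) (hi 0 b),
    intervalIntegral.integral_mul_const, integral_fderiv_apply_const hφ]
  ring

end SliceBalance

lemma abs_integral_fderiv_apply_sub_le {η q : ℝ → ℝ} {u φ : ℝ × ℝ → ℝ} {t x₀ x₁ m B ε : ℝ}
    (hB : ∀ p, ‖fderiv ℝ φ p‖ ≤ B) (hx : x₀ ≤ x₁)
    (hm : ∀ x ∈ Icc x₀ x₁, dist (η m, q m) (η (u (t, x)), q (u (t, x))) ≤ ε) :
    |∫ x in x₀..x₁, fderiv ℝ φ (t, x) (η m - η (u (t, x)), q m - q (u (t, x)))|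
      ≤ B * ε * (x₁ - x₀) := by
  rw [← abs_of_nonneg (sub_nonneg.2 hx), ← Real.norm_eq_abs]
  refine intervalIntegral.norm_integral_le_of_norm_le_const fun x hx' => ?_
  rw [uIoc_of_le hx] at hx'
  refine (fderiv ℝ φ (t, x)).le_of_opNorm_le_of_le (hB _) ?_
  simpa only [dist_eq_norm, Prod.mk_sub_mk] using hm x (Ioc_subset_Icc_self hx')

namespace IsEntropyPair

variable {f η q : ℝ → ℝ} {u φ : ℝ × ℝ → ℝ} {t B c ε κ : ℝ}

lemma abs_mul_sub_sub_le (h : IsEntropyPair f η q) {F m m' : ℝ}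
    (hc : ∀ s ∈ uIcc m m', |deriv η s| ≤ c) (hκ : ∀ s ∈ uIcc m m', |F - deriv f s| ≤ κ) :
    |(η m' - η m) * F - (q m' - q m)| ≤ c * κ * |m' - m| := by
  have hderiv (s : ℝ) : HasDerivAt (fun s => η s * F - q s) (deriv η s * (F - deriv f s)) s := by
    refine (((h.entropy_smooth.differentiable one_ne_zero s).hasDerivAt.mul_const F).sub
      (h.flux_smooth.differentiable one_ne_zero s).hasDerivAt).congr_deriv ?_
    rw [h.deriv_flux]
    ring
  have hbound : ∀ s ∈ uIcc m m', ‖deriv η s * (F - deriv f s)‖ ≤ c * κ := fun s hs => by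
    rw [norm_mul]
    exact mul_le_mul (hc s hs) (hκ s hs) (abs_nonneg _) ((abs_nonneg _).trans (hc s hs))
  have := (convex_uIcc m m').norm_image_sub_le_of_norm_hasDerivWithin_le
    (fun s _ => (hderiv s).hasDerivWithinAt) hbound left_mem_uIcc right_mem_uIcc
  simp only [Real.norm_eq_abs] at this
  convert this using 2
  ring

lemma sum_sliceBalance_mul_sub (h : IsEntropyPair f η q) (hφ : ContDiff ℝ 1 φ)
    (hu : Continuous u) (X M : ℕ → ℝ) {n : ℕ} (hM₀ : M 0 = u (t, X 0)) (hMn : M n = u (t, X n)) :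
    ∑ j ∈ Finset.range n, sliceBalance f 1 0 u φ t (X j) (X (j + 1)) * η (M j)
        - sliceBalance f η q u φ t (X 0) (X n)
      = ∑ j ∈ Finset.range n, ((∫ x in X j..X (j + 1), fderiv ℝ φ (t, x)
          (η (M j) - η (u (t, x)), q (M j) - q (u (t, x)))) -
        φ (t, X (j + 1)) * ((η (M (j + 1)) - η (M j)) * deriv f (u (t, X (j + 1))) -
          (q (M (j + 1)) - q (M j)))) := by
  have hη := h.entropy_smooth.continuous
  have hq := h.flux_smooth.continuous
  have hflux : relFlux f η q u φ (t, X n) - relFlux f η q u φ (t, X 0)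
      = ∑ j ∈ Finset.range n,
        (φ (t, X (j + 1)) * (η (M (j + 1)) * deriv f (u (t, X (j + 1))) - q (M (j + 1))) -
          φ (t, X j) * (η (M j) * deriv f (u (t, X j)) - q (M j))) := by
    rw [Finset.sum_range_sub fun j => φ (t, X j) * (η (M j) * deriv f (u (t, X j)) - q (M j)),
      hM₀, hMn]
    rfl
  have hi (j : ℕ) := intervalIntegrable_fderiv_apply_pair (t := t) hη hq hu hφ (X j) (X (j + 1))
  have hi' (j : ℕ) := intervalIntegrable_fderiv_apply_pair (t := t) (η := fun _ => η (M j))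
    (q := fun _ => q (M j)) continuous_const continuous_const hu hφ (X j) (X (j + 1))
  rw [sliceBalance, hflux, ← intervalIntegral.sum_integral_adjacent_intervals fun j _ => hi j,
    ← Finset.sum_add_distrib, ← Finset.sum_sub_distrib]
  refine Finset.sum_congr rfl fun j _ => ?_
  simp only [← Prod.mk_sub_mk, map_sub]
  rw [intervalIntegral.integral_sub (hi' j) (hi j), sliceBalance_one_zero_mul hφ _ _ _ (q (M j))]
  ring

/-- Where the chain moves, it moves through values that `u` takes in the adjacent cell: this is why
the increments of `q` are those of `η` multiplied by the speed of the cell's right end. -/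
lemma abs_medianChain_increment_le (h : IsEntropyPair f η q) {v : ℝ → ℝ} (hv : Continuous v)
    {X : ℕ → ℝ} {j : ℕ} (hX : X j ≤ X (j + 1))
    (hc : ∀ x ∈ Icc (X j) (X (j + 1)), |deriv η (v x)| ≤ c)
    (hκ : ∀ x ∈ Icc (X j) (X (j + 1)), |deriv f (v (X (j + 1))) - deriv f (v x)| ≤ κ)
    {M : ℕ → ℝ} {V : ℝ} (hM : M = medianChain V fun i => v (X i)) :
    |(η (M (j + 1)) - η (M j)) * deriv f (v (X (j + 1))) - (q (M (j + 1)) - q (M j))|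
      ≤ c * κ * |M (j + 1) - M j| := by
  by_cases hmove : M (j + 1) = M j
  · simp [hmove]
  have hvalues : uIcc (M j) (M (j + 1)) ⊆ v '' Icc (X j) (X (j + 1)) := by
    subst hM
    refine (uIcc_medianChain_subset hmove).trans ?_
    rw [← uIcc_of_le hX]
    exact intermediate_value_uIcc hv.continuousOn
  refine h.abs_mul_sub_sub_le (fun s hs => ?_) fun s hs => ?_
  · obtain ⟨x, hx, rfl⟩ := hvalues hs
    exact hc x hx
  · obtain ⟨x, hx, rfl⟩ := hvalues hs
    exact hκ x hx

lemma abs_sum_sliceBalance_mul_medianChain_sub_le (h : IsEntropyPair f η q)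
    (hφ : ContDiff ℝ 1 φ) (hu : Continuous u) {n : ℕ} {X : ℕ → ℝ} (hX : Monotone X)
    (hB : ∀ p, |φ p| ≤ B) (hB' : ∀ p, ‖fderiv ℝ φ p‖ ≤ B)
    (hosc : ∀ x ∈ Icc (X 0) (X n), ∀ x' ∈ Icc (X 0) (X n),
      dist (η (u (t, x)), q (u (t, x))) (η (u (t, x')), q (u (t, x'))) ≤ ε)
    (hc : ∀ x ∈ Icc (X 0) (X n), |deriv η (u (t, x))| ≤ c)
    (hκ : ∀ j, ∀ x ∈ Icc (X j) (X (j + 1)),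
      |deriv f (u (t, X (j + 1))) - deriv f (u (t, x))| ≤ κ) :
    |∑ j ∈ Finset.range n, sliceBalance f 1 0 u φ t (X j) (X (j + 1)) *
          η (medianChain (u (t, X n)) (fun i => u (t, X i)) j) -
        sliceBalance f η q u φ t (X 0) (X n)|
      ≤ B * ε * (X n - X 0) + B * (c * κ * |u (t, X 0) - u (t, X n)|) := by
  have hB₀ : 0 ≤ B := (abs_nonneg _).trans (hB 0)
  have hX₀ : X 0 ∈ Icc (X 0) (X n) := left_mem_Icc.2 (hX (Nat.zero_le n))
  have hcκ : 0 ≤ c * κ := mul_nonneg ((abs_nonneg _).trans (hc _ hX₀))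
    ((abs_nonneg _).trans (hκ 0 _ (left_mem_Icc.2 (hX (Nat.zero_le 1)))))
  have hv : Continuous fun x => u (t, x) := by fun_prop
  set M := medianChain (u (t, X n)) fun i => u (t, X i) with hM
  have hcell {j : ℕ} (hj : j < n) : Icc (X j) (X (j + 1)) ⊆ Icc (X 0) (X n) :=
    Icc_subset_Icc (hX (Nat.zero_le j)) (hX hj)
  have hvalues {j : ℕ} (hj : j < n) : M j ∈ (fun x => u (t, x)) '' Icc (X 0) (X n) :=
    have : OrdConnected ((fun x => u (t, x)) '' Icc (X 0) (X n)) :=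
      (isPreconnected_Icc.image _ hv.continuousOn).ordConnected
    medianChain_mem fun i hi => mem_image_of_mem _ ⟨hX (Nat.zero_le i), hX (hi.trans hj.le)⟩
  have hosc_le {j : ℕ} (hj : j < n) : |∫ x in X j..X (j + 1), fderiv ℝ φ (t, x)
      (η (M j) - η (u (t, x)), q (M j) - q (u (t, x)))| ≤ B * ε * (X (j + 1) - X j) := by
    obtain ⟨x', hx', hMx'⟩ := hvalues hj
    exact hMx' ▸ abs_integral_fderiv_apply_sub_le hB' (hX j.le_succ) fun x hx =>
      hosc x' hx' x (hcell hj hx)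
  have hincr {j : ℕ} (hj : j < n) : |φ (t, X (j + 1)) *
      ((η (M (j + 1)) - η (M j)) * deriv f (u (t, X (j + 1))) - (q (M (j + 1)) - q (M j)))|
        ≤ B * (c * κ * |M (j + 1) - M j|) := by
    rw [abs_mul]
    exact mul_le_mul (hB _) (h.abs_medianChain_increment_le hv (hX j.le_succ)
      (fun x hx => hc x (hcell hj hx)) (hκ j) hM) (abs_nonneg _) hB₀
  rw [h.sum_sliceBalance_mul_sub hφ hu X M rfl
    (medianChain_eq_last (fun i => u (t, X i)) n)]
  refine (Finset.abs_sum_le_sum_abs _ _).trans <| (Finset.sum_le_sum fun j hj =>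
    (abs_sub _ _).trans (add_le_add (hosc_le (Finset.mem_range.1 hj))
      (hincr (Finset.mem_range.1 hj)))).trans ?_
  rw [Finset.sum_add_distrib, ← Finset.mul_sum, ← Finset.mul_sum, ← Finset.mul_sum,
    Finset.sum_range_sub X]
  gcongr
  exact sum_abs_medianChain_le _ _ n

end IsEntropyPair

/-! ### Strips of characteristics -/

/-- The part `a ≤ t ≤ b`, `χ t y₀ ≤ x ≤ χ t y₁` of the plane is swept by the curves `χ · y`, which
are characteristics of `u` and along which `u` is `G`-Lipschitz. To avoid conditions on the domain,
`u` and `χ` are continuous on the whole plane. -/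
structure IsCharacteristicStrip (f : ℝ → ℝ) (u : ℝ × ℝ → ℝ) (χ : ℝ → ℝ → ℝ) (G : ℝ≥0)
    (a b y₀ y₁ : ℝ) : Prop where
  time_le : a ≤ b
  param_le : y₀ ≤ y₁
  continuous : Continuous u
  continuous_param : Continuous fun p : ℝ × ℝ => χ p.1 p.2
  monotone : ∀ t, Monotone (χ t)
  hasDerivAt : ∀ t ∈ Icc a b, ∀ y ∈ Icc y₀ y₁,
    HasDerivAt (fun s => χ s y) (deriv f (u (t, χ t y))) t
  lipschitzOnWith : ∀ y ∈ Icc y₀ y₁, LipschitzOnWith G (fun t => u (t, χ t y)) (Icc a b)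

namespace IsCharacteristicStrip

variable {f η q : ℝ → ℝ} {u φ ψ : ℝ × ℝ → ℝ} {χ : ℝ → ℝ → ℝ} {G c K : ℝ≥0} {a b y₀ y₁ : ℝ}
  {B ε : ℝ} {n : ℕ} {z : ℕ → ℝ}

lemma subset (hS : IsCharacteristicStrip f u χ G a b y₀ y₁) {z₀ z₁ : ℝ} (hz : z₀ ≤ z₁)
    (hsub : Icc z₀ z₁ ⊆ Icc y₀ y₁) : IsCharacteristicStrip f u χ G a b z₀ z₁ where
  __ := hS
  param_le := hz
  hasDerivAt t ht y hy := hS.hasDerivAt t ht y (hsub hy)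
  lipschitzOnWith y hy := hS.lipschitzOnWith y (hsub hy)

lemma continuous_curve (hS : IsCharacteristicStrip f u χ G a b y₀ y₁) (y : ℝ) :
    Continuous fun t => χ t y :=
  hS.continuous_param.comp (by fun_prop : Continuous fun t : ℝ => (t, y))

lemma Icc_subset_image (hS : IsCharacteristicStrip f u χ G a b y₀ y₁) {z₀ z₁ : ℝ} (hz : z₀ ≤ z₁)
    (t : ℝ) : Icc (χ t z₀) (χ t z₁) ⊆ χ t '' Icc z₀ z₁ :=
  intermediate_value_Icc hz
    (hS.continuous_param.comp (by fun_prop : Continuous fun y : ℝ => (t, y))).continuousOn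

lemma continuous_value (hS : IsCharacteristicStrip f u χ G a b y₀ y₁) :
    Continuous fun p : ℝ × ℝ => u (p.1, χ p.1 p.2) :=
  hS.continuous.comp (continuous_fst.prodMk hS.continuous_param)

lemma continuous_sliceBalance (hS : IsCharacteristicStrip f u χ G a b y₀ y₁)
    (hf : ContDiff ℝ 1 f) (hη : Continuous η) (hq : Continuous q) (hφ : ContDiff ℝ 1 φ)
    (z₀ z₁ : ℝ) : Continuous fun t => sliceBalance f η q u φ t (χ t z₀) (χ t z₁) :=
  _root_.continuous_sliceBalance hf hη hq hS.continuous hφ (hS.continuous_curve z₀)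
    (hS.continuous_curve z₁)

lemma sum_integral (hS : IsCharacteristicStrip f u χ G a b y₀ y₁) (hψ : Continuous ψ)
    (z : ℕ → ℝ) (n : ℕ) :
    ∑ j ∈ Finset.range n, ∫ t in a..b, ∫ x in χ t (z j)..χ t (z (j + 1)), ψ (t, x)
      = ∫ t in a..b, ∫ x in χ t (z 0)..χ t (z n), ψ (t, x) := by
  rw [← intervalIntegral.integral_finsetSum fun j _ => (continuous_integral_moving hψ
    (hS.continuous_curve _) (hS.continuous_curve _)).intervalIntegrable _ _]
  congr with t
  exact intervalIntegral.sum_integral_adjacent_intervals (a := fun j => χ t (z j)) fun j _ =>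
    (hψ.comp (by fun_prop : Continuous fun x : ℝ => (t, x))).intervalIntegrable _ _

/-- Integration by parts in time, since `sliceBalance f 1 0` is the derivative of the mass. -/
lemma abs_integral_sliceBalance_mul_le (hS : IsCharacteristicStrip f u χ G a b y₀ y₁)
    (hf : ContDiff ℝ 1 f) (hφ : ContDiff ℝ 1 φ) (hφa : ∀ x, φ (a, x) = 0)
    (hφb : ∀ x, φ (b, x) = 0) {H : ℝ → ℝ} (hH : LipschitzOnWith K H (Icc a b)) :
    |∫ t in a..b, sliceBalance f 1 0 u φ t (χ t y₀) (χ t y₁) * H t|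
      ≤ K * ∫ t in a..b, ∫ x in χ t y₀..χ t y₁, |φ (t, x)| := by
  have hmass {ψ : ℝ × ℝ → ℝ} (hψ : Continuous ψ) :
      IntervalIntegrable (fun t => ∫ x in χ t y₀..χ t y₁, ψ (t, x)) volume a b :=
    (continuous_integral_moving hψ (hS.continuous_curve _)
      (hS.continuous_curve _)).intervalIntegrable _ _
  refine (abs_integral_deriv_mul_le hS.time_le
    (P := fun t => ∫ x in χ t y₀..χ t y₁, φ (t, x)) (fun t ht =>
      hasDerivAt_integral_between_characteristics hφ
        (hS.hasDerivAt t ht _ (left_mem_Icc.2 hS.param_le))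
        (hS.hasDerivAt t ht _ (right_mem_Icc.2 hS.param_le)))
    (hS.continuous_sliceBalance hf continuous_const continuous_const hφ _ _).continuousOn
    (by simp [hφa]) (by simp [hφb]) hH).trans ?_
  gcongr
  exact intervalIntegral.integral_mono_on hS.time_le (hmass hφ.continuous).abs
    (hmass hφ.continuous.abs) fun t _ =>
      intervalIntegral.abs_integral_le_integral_abs (hS.monotone t hS.param_le)

lemma abs_integral_sum_sliceBalance_mul_le (hS : IsCharacteristicStrip f u χ G a b y₀ y₁)
    (hf : ContDiff ℝ 1 f) (hφ : ContDiff ℝ 1 φ) (hφa : ∀ x, φ (a, x) = 0)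
    (hφb : ∀ x, φ (b, x) = 0) (hz : Monotone z) (hzmem : ∀ j, z j ∈ Icc y₀ y₁)
    {H : ℕ → ℝ → ℝ} (hH : ∀ j, LipschitzOnWith K (H j) (Icc a b)) :
    |∫ t in a..b, ∑ j ∈ Finset.range n,
        sliceBalance f 1 0 u φ t (χ t (z j)) (χ t (z (j + 1))) * H j t|
      ≤ K * ∫ t in a..b, ∫ x in χ t (z 0)..χ t (z n), |φ (t, x)| := by
  have hi (j : ℕ) : IntervalIntegrable
      (fun t => sliceBalance f 1 0 u φ t (χ t (z j)) (χ t (z (j + 1))) * H j t) volume a b :=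
    ((hS.continuous_sliceBalance hf continuous_const continuous_const hφ _ _).continuousOn.mul
      (hH j).continuousOn).intervalIntegrable_of_Icc hS.time_le
  rw [intervalIntegral.integral_finsetSum fun j _ => hi j, ← hS.sum_integral hφ.continuous.abs,
    Finset.mul_sum]
  exact (Finset.abs_sum_le_sum_abs _ _).trans <| Finset.sum_le_sum fun j _ =>
    (hS.subset (hz j.le_succ) (Icc_subset_Icc (hzmem j).1
      (hzmem (j + 1)).2)).abs_integral_sliceBalance_mul_le hf hφ hφa hφb (hH j)

lemma lipschitzOnWith_medianChain (hS : IsCharacteristicStrip f u χ G a b y₀ y₁)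
    (hη : Differentiable ℝ η)
    (hc : ∀ t ∈ Icc a b, ∀ y ∈ Icc y₀ y₁, |deriv η (u (t, χ t y))| ≤ c)
    (hz : ∀ j, z j ∈ Icc y₀ y₁) (n j : ℕ) :
    LipschitzOnWith (c * G)
      (fun t => η (medianChain (u (t, χ t (z n))) (fun i => u (t, χ t (z i))) j)) (Icc a b) := by
  set S := (fun p : ℝ × ℝ => u (p.1, χ p.1 p.2)) '' Icc a b ×ˢ Icc y₀ y₁
  have hS_conn : OrdConnected S := ((isPreconnected_Icc.prod isPreconnected_Icc).image _
    hS.continuous_value.continuousOn).ordConnected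
  have hηS : LipschitzOnWith c η S :=
    hS_conn.convex.lipschitzOnWith_of_nnnorm_deriv_le (fun s _ => hη s) <| by
      rintro _ ⟨⟨t, y⟩, ⟨ht, hy⟩, rfl⟩
      exact hc t ht y hy
  refine hηS.comp (LipschitzOnWith.of_dist_le_mul fun s hs t ht => ?_) fun t ht =>
    medianChain_mem fun i _ => ⟨(t, z i), ⟨ht, hz i⟩, rfl⟩
  exact abs_medianChain_sub_medianChain_le ((hS.lipschitzOnWith _ (hz n)).dist_le_mul s hs t ht)
    fun i _ => (hS.lipschitzOnWith _ (hz i)).dist_le_mul s hs t ht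

lemma abs_sum_sliceBalance_mul_sub_le (hS : IsCharacteristicStrip f u χ G a b y₀ y₁)
    (h : IsEntropyPair f η q) (hφ : ContDiff ℝ 1 φ) (hB : ∀ p, |φ p| ≤ B)
    (hB' : ∀ p, ‖fderiv ℝ φ p‖ ≤ B) {t : ℝ} (hc : ∀ y ∈ Icc y₀ y₁, |deriv η (u (t, χ t y))| ≤ c)
    (hosc : ∀ y ∈ Icc y₀ y₁, ∀ y' ∈ Icc y₀ y₁,
      dist (η (u (t, χ t y)), q (u (t, χ t y))) (η (u (t, χ t y')), q (u (t, χ t y'))) ≤ ε)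
    {κ : ℝ} (hz : Monotone z) (hz₀ : z 0 = y₀) (hzn : z n = y₁)
    (hκ : ∀ j, ∀ y ∈ Icc (z j) (z (j + 1)), ∀ y' ∈ Icc (z j) (z (j + 1)),
      dist (deriv f (u (t, χ t y))) (deriv f (u (t, χ t y'))) ≤ κ) :
    |∑ j ∈ Finset.range n, sliceBalance f 1 0 u φ t (χ t (z j)) (χ t (z (j + 1))) *
          η (medianChain (u (t, χ t (z n))) (fun i => u (t, χ t (z i))) j) -
        sliceBalance f η q u φ t (χ t y₀) (χ t y₁)|
      ≤ B * ε * (χ t y₁ - χ t y₀) + B * (c * κ * |u (t, χ t y₀) - u (t, χ t y₁)|) := by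
  subst hz₀ hzn
  have param := hS.Icc_subset_image hS.param_le t
  refine h.abs_sum_sliceBalance_mul_medianChain_sub_le (X := fun j => χ t (z j)) hφ
    hS.continuous ((hS.monotone t).comp hz) hB hB' (fun x hx x' hx' => ?_) (fun x hx => ?_)
    fun j x hx => ?_
  · obtain ⟨y, hy, rfl⟩ := param hx
    obtain ⟨y', hy', rfl⟩ := param hx'
    exact hosc y hy y' hy'
  · obtain ⟨y, hy, rfl⟩ := param hx
    exact hc y hy
  · obtain ⟨y, hy, rfl⟩ := hS.Icc_subset_image (hz j.le_succ) t hx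
    exact hκ j _ (right_mem_Icc.2 (hz j.le_succ)) y hy

lemma abs_integral_sum_sliceBalance_mul_sub_le (hS : IsCharacteristicStrip f u χ G a b y₀ y₁)
    (hf : ContDiff ℝ 1 f) (h : IsEntropyPair f η q)
    (hc : ∀ t ∈ Icc a b, ∀ y ∈ Icc y₀ y₁, |deriv η (u (t, χ t y))| ≤ c)
    (hφ : ContDiff ℝ 1 φ) (hB : ∀ p, |φ p| ≤ B) (hB' : ∀ p, ‖fderiv ℝ φ p‖ ≤ B)
    (hosc : ∀ t ∈ Icc a b, ∀ y ∈ Icc y₀ y₁, ∀ y' ∈ Icc y₀ y₁,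
      dist (η (u (t, χ t y)), q (u (t, χ t y))) (η (u (t, χ t y')), q (u (t, χ t y'))) ≤ ε)
    {κ : ℝ} (hz : Monotone z) (hz₀ : z 0 = y₀) (hzn : z n = y₁)
    (hzmem : ∀ j, z j ∈ Icc y₀ y₁)
    (hκ : ∀ j, ∀ y ∈ Icc (z j) (z (j + 1)), ∀ y' ∈ Icc (z j) (z (j + 1)), ∀ t ∈ Icc a b,
      dist (deriv f (u (t, χ t y))) (deriv f (u (t, χ t y'))) ≤ κ) :
    |(∫ t in a..b, ∑ j ∈ Finset.range n, sliceBalance f 1 0 u φ t (χ t (z j)) (χ t (z (j + 1))) *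
          η (medianChain (u (t, χ t (z n))) (fun i => u (t, χ t (z i))) j)) -
        ∫ t in a..b, sliceBalance f η q u φ t (χ t y₀) (χ t y₁)|
      ≤ B * ε * (∫ t in a..b, (χ t y₁ - χ t y₀)) +
        κ * (B * c * ∫ t in a..b, |u (t, χ t y₀) - u (t, χ t y₁)|) := by
  have hη := h.entropy_smooth
  have hsum : ContinuousOn (fun t => ∑ j ∈ Finset.range n,
      sliceBalance f 1 0 u φ t (χ t (z j)) (χ t (z (j + 1))) *
        η (medianChain (u (t, χ t (z n))) (fun i => u (t, χ t (z i))) j)) (Icc a b) :=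
    continuousOn_finsetSum _ fun j _ => (hS.continuous_sliceBalance hf continuous_const
      continuous_const hφ _ _).continuousOn.mul
        (hS.lipschitzOnWith_medianChain (hη.differentiable one_ne_zero) hc hzmem n j).continuousOn
  have hwidth : IntervalIntegrable (fun t => χ t y₁ - χ t y₀) volume a b :=
    ((hS.continuous_curve y₁).sub (hS.continuous_curve y₀)).intervalIntegrable _ _
  have hvalue (y : ℝ) : Continuous fun t => u (t, χ t y) :=
    hS.continuous.comp (continuous_id.prodMk (hS.continuous_curve y))
  have hjump : IntervalIntegrable (fun t => |u (t, χ t y₀) - u (t, χ t y₁)|) volume a b :=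
    ((hvalue y₀).sub (hvalue y₁)).abs.intervalIntegrable _ _
  rw [← intervalIntegral.integral_sub (hsum.intervalIntegrable_of_Icc hS.time_le)
    ((hS.continuous_sliceBalance hf hη.continuous h.flux_smooth.continuous hφ _
      _).intervalIntegrable _ _), ← Real.norm_eq_abs]
  refine (intervalIntegral.norm_integral_le_of_norm_le hS.time_le (ae_of_all _ fun t ht =>
    hS.abs_sum_sliceBalance_mul_sub_le h hφ hB hB' (hc t (Ioc_subset_Icc_self ht))
      (hosc t (Ioc_subset_Icc_self ht)) hz hz₀ hzn fun j y hy y' hy' =>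
        hκ j y hy y' hy' t (Ioc_subset_Icc_self ht))
    ((hwidth.const_mul _).add ((hjump.const_mul _).const_mul _))).trans_eq ?_
  rw [intervalIntegral.integral_add (hwidth.const_mul _) ((hjump.const_mul _).const_mul _)]
  simp only [intervalIntegral.integral_const_mul]
  ring

lemma abs_integral_sliceBalance_le_of_dist_le (hS : IsCharacteristicStrip f u χ G a b y₀ y₁)
    (hf : ContDiff ℝ 1 f) (h : IsEntropyPair f η q)
    (hc : ∀ t ∈ Icc a b, ∀ y ∈ Icc y₀ y₁, |deriv η (u (t, χ t y))| ≤ c)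
    (hφ : ContDiff ℝ 1 φ) (hφa : ∀ x, φ (a, x) = 0) (hφb : ∀ x, φ (b, x) = 0)
    (hB : ∀ p, |φ p| ≤ B) (hB' : ∀ p, ‖fderiv ℝ φ p‖ ≤ B)
    (hosc : ∀ t ∈ Icc a b, ∀ y ∈ Icc y₀ y₁, ∀ y' ∈ Icc y₀ y₁,
      dist (η (u (t, χ t y)), q (u (t, χ t y))) (η (u (t, χ t y')), q (u (t, χ t y'))) ≤ ε) :
    |∫ t in a..b, sliceBalance f η q u φ t (χ t y₀) (χ t y₁)|
      ≤ c * G * (∫ t in a..b, ∫ x in χ t y₀..χ t y₁, |φ (t, x)|)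
        + B * ε * ∫ t in a..b, (χ t y₁ - χ t y₀) := by
  refine le_of_forall_pos_le_add_mul
    (z := B * c * ∫ t in a..b, |u (t, χ t y₀) - u (t, χ t y₁)|) fun κ hκ => ?_
  obtain ⟨n, z, hz, hz₀, hzn, hzmem, hosc'⟩ := exists_partition_forall_dist_le
    (isCompact_Icc (a := a) (b := b)) hS.param_le hκ
    ((hf.continuous_deriv le_rfl).comp hS.continuous_value)
  have hdiff := hS.abs_integral_sum_sliceBalance_mul_sub_le hf h hc hφ hB hB' hosc hz hz₀ hzn
    hzmem hosc'
  have hsum := hS.abs_integral_sum_sliceBalance_mul_le hf hφ hφa hφb hz hzmem (n := n)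
    (hS.lipschitzOnWith_medianChain (h.entropy_smooth.differentiable one_ne_zero) hc hzmem n)
  rw [hz₀, NNReal.coe_mul] at hsum
  conv_rhs at hsum => rw [hzn]
  rw [abs_sub_comm] at hdiff
  linarith [(abs_sub_abs_le_abs_sub _ _).trans hdiff]

lemma abs_integral_sliceBalance_le (hS : IsCharacteristicStrip f u χ G a b y₀ y₁)
    (hf : ContDiff ℝ 1 f) (h : IsEntropyPair f η q)
    (hc : ∀ t ∈ Icc a b, ∀ y ∈ Icc y₀ y₁, |deriv η (u (t, χ t y))| ≤ c)
    (hφ : ContDiff ℝ 1 φ) (hφ_supp : HasCompactSupport φ) (hφa : ∀ x, φ (a, x) = 0)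
    (hφb : ∀ x, φ (b, x) = 0) :
    |∫ t in a..b, sliceBalance f η q u φ t (χ t y₀) (χ t y₁)|
      ≤ c * G * ∫ t in a..b, ∫ x in χ t y₀..χ t y₁, |φ (t, x)| := by
  have hη := h.entropy_smooth.continuous
  have hq := h.flux_smooth.continuous
  obtain ⟨B₀, hB₀⟩ := hφ_supp.exists_bound_of_continuous hφ.continuous
  obtain ⟨B₁, hB₁⟩ :=
    (hφ_supp.fderiv ℝ).exists_bound_of_continuous (hφ.continuous_fderiv one_ne_zero)
  refine le_of_forall_pos_le_add_mul
    (z := max B₀ B₁ * ∫ t in a..b, (χ t y₁ - χ t y₀)) fun ε hε => ?_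
  obtain ⟨n, z, hz, hz₀, hzn, hzmem, hosc⟩ := exists_partition_forall_dist_le
    (isCompact_Icc (a := a) (b := b)) hS.param_le hε
    ((hη.prodMk hq).comp hS.continuous_value)
  have hsub (j : ℕ) : Icc (z j) (z (j + 1)) ⊆ Icc y₀ y₁ :=
    Icc_subset_Icc (hzmem j).1 (hzmem (j + 1)).2
  have hcell (j : ℕ) := (hS.subset (hz j.le_succ) (hsub j)).abs_integral_sliceBalance_le_of_dist_le
    hf h (fun t ht y hy => hc t ht y (hsub j hy)) hφ hφa hφb
    (fun p => (hB₀ p).trans (le_max_left B₀ B₁)) (fun p => (hB₁ p).trans (le_max_right B₀ B₁))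
    fun t ht y hy y' hy' => hosc j y hy y' hy' t ht
  have htelescope (t : ℝ) :
      ∑ j ∈ Finset.range n, (χ t (z (j + 1)) - χ t (z j)) = χ t y₁ - χ t y₀ := by
    rw [Finset.sum_range_sub fun j => χ t (z j), hz₀, hzn]
  have hw (j : ℕ) : IntervalIntegrable (fun t => χ t (z (j + 1)) - χ t (z j)) volume a b :=
    ((hS.continuous_curve _).sub (hS.continuous_curve _)).intervalIntegrable _ _
  have hsum := (Finset.abs_sum_le_sum_abs _ _).trans
    (Finset.sum_le_sum fun j (_ : j ∈ Finset.range n) => hcell j)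
  rw [Finset.sum_add_distrib, ← Finset.mul_sum, ← Finset.mul_sum,
    hS.sum_integral hφ.continuous.abs, ← intervalIntegral.integral_finsetSum fun j _ =>
      (hS.continuous_sliceBalance hf hη hq hφ _ _).intervalIntegrable _ _,
    ← intervalIntegral.integral_finsetSum fun j _ => hw j] at hsum
  simp only [Nat.succ_eq_add_one, sum_sliceBalance hη hq hS.continuous hφ fun j => χ _ (z j),
    htelescope, hz₀, hzn] at hsum
  exact hsum.trans_eq (by ring)

end IsCharacteristicStrip

namespace IsTestFunction

variable {E : Type*} [NormedAddCommGroup E] [NormedSpace ℝ E] {U V : Set E} {φ ψ : E → ℝ}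

lemma add (hφ : IsTestFunction U φ) (hψ : IsTestFunction U ψ) : IsTestFunction U (φ + ψ) :=
  ⟨hφ.smooth.add hψ.smooth, hφ.compact.add hψ.compact,
    (tsupport_add φ ψ).trans (union_subset hφ.supp hψ.supp)⟩

lemma const_smul (hφ : IsTestFunction U φ) (r : ℝ) : IsTestFunction U (r • φ) :=
  ⟨hφ.smooth.const_smul r, hφ.compact.smul_left (f := fun _ => r),
    (tsupport_smul_subset_right (fun _ => r) φ).trans hφ.supp⟩

lemma zero (U : Set E) : IsTestFunction U 0 :=
  ⟨contDiff_const, HasCompactSupport.zero, by simp [tsupport_zero]⟩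

lemma mono (hUV : U ⊆ V) (hφ : IsTestFunction U φ) : IsTestFunction V φ :=
  ⟨hφ.smooth, hφ.compact, hφ.supp.trans hUV⟩

lemma contDiff_one (hφ : IsTestFunction U φ) : ContDiff ℝ 1 φ :=
  hφ.smooth.of_le (by norm_num)

lemma eq_zero (hφ : IsTestFunction U φ) {x : E} (hx : x ∉ U) : φ x = 0 :=
  image_eq_zero_of_notMem_tsupport fun h => hx (hφ.supp h)

lemma fderiv_eq_zero (hφ : IsTestFunction U φ) {x : E} (hx : x ∉ U) : fderiv ℝ φ x = 0 :=
  image_eq_zero_of_notMem_tsupport fun h => hx (hφ.supp (tsupport_fderiv_subset ℝ h))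

lemma integrable_abs [MeasurableSpace E] [OpensMeasurableSpace E] {μ : Measure E}
    [IsFiniteMeasureOnCompacts μ] (hφ : IsTestFunction U φ) : Integrable (fun x => |φ x|) μ :=
  (hφ.smooth.continuous.integrable_of_hasCompactSupport hφ.compact).abs

end IsTestFunction

lemma integral_eq_integral_between {θ : ℝ × ℝ → ℝ} (hθ : Integrable θ) {a b : ℝ} (hab : a ≤ b)
    {α β : ℝ → ℝ} (hαβ : ∀ t, α t ≤ β t)
    (h : ∀ p, ¬(p.1 ∈ Ioo a b ∧ p.2 ∈ Ioo (α p.1) (β p.1)) → θ p = 0) :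
    ∫ p, θ p = ∫ t in a..b, ∫ x in α t..β t, θ (t, x) := by
  have hslice (t : ℝ) : ∫ x, θ (t, x) = ∫ x in α t..β t, θ (t, x) := by
    rw [intervalIntegral.integral_of_le (hαβ t)]
    exact (setIntegral_eq_integral_of_forall_compl_eq_zero fun x hx =>
      h _ fun hx' => hx (Ioo_subset_Ioc_self hx'.2)).symm
  rw [Measure.volume_eq_prod] at hθ ⊢
  rw [integral_prod _ hθ, intervalIntegral.integral_of_le hab,
    ← setIntegral_eq_integral_of_forall_compl_eq_zero (s := Ioc a b) fun t ht => ?_]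
  · simp only [hslice]
  · have hzero (x : ℝ) : θ (t, x) = 0 := h _ fun hx' => ht (Ioo_subset_Ioc_self hx'.1)
    simp only [hzero, integral_zero]

/-- The open region between the times `a`, `b` and the curves `χ · y₀`, `χ · y₁`: the interior of
a characteristic strip. -/
def openStrip (χ : ℝ → ℝ → ℝ) (a b y₀ y₁ : ℝ) : Set (ℝ × ℝ) :=
  {p | p.1 ∈ Ioo a b ∧ p.2 ∈ Ioo (χ p.1 y₀) (χ p.1 y₁)}

namespace IsCharacteristicStrip

variable {f η q : ℝ → ℝ} {u φ : ℝ × ℝ → ℝ} {χ : ℝ → ℝ → ℝ} {G c : ℝ≥0} {a b y₀ y₁ : ℝ}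

lemma isOpen_openStrip (hS : IsCharacteristicStrip f u χ G a b y₀ y₁) :
    IsOpen (openStrip χ a b y₀ y₁) := by
  have hcurve (y : ℝ) : Continuous fun p : ℝ × ℝ => χ p.1 y :=
    (hS.continuous_curve y).comp continuous_fst
  exact (isOpen_Ioo.preimage continuous_fst).inter
    ((isOpen_lt (hcurve y₀) continuous_snd).inter (isOpen_lt continuous_snd (hcurve y₁)))

lemma openStrip_subset (hS : IsCharacteristicStrip f u χ G a b y₀ y₁) {N : Set (ℝ × ℝ)}
    (hN : ∀ t ∈ Icc a b, ∀ y ∈ Icc y₀ y₁, (t, χ t y) ∈ N) : openStrip χ a b y₀ y₁ ⊆ N := by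
  rintro ⟨t, x⟩ ⟨ht, hx⟩
  obtain ⟨y, hy, rfl⟩ := hS.Icc_subset_image hS.param_le t (Ioo_subset_Icc_self hx)
  exact hN t (Ioo_subset_Icc_self ht) y hy

lemma abs_integral_fderiv_apply_pair_le (hS : IsCharacteristicStrip f u χ G a b y₀ y₁)
    (hf : ContDiff ℝ 1 f) (h : IsEntropyPair f η q)
    (hc : ∀ t ∈ Icc a b, ∀ y ∈ Icc y₀ y₁, |deriv η (u (t, χ t y))| ≤ c)
    (hφ : IsTestFunction (openStrip χ a b y₀ y₁) φ) :
    |∫ p, fderiv ℝ φ p (η (u p), q (u p))| ≤ c * G * ∫ p, |φ p| := by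
  have hcont := continuous_fderiv_apply_pair h.entropy_smooth.continuous
    h.flux_smooth.continuous hS.continuous hφ.contDiff_one
  have hint : Integrable fun p => fderiv ℝ φ p (η (u p), q (u p)) :=
    hcont.integrable_of_hasCompactSupport <| (hφ.compact.fderiv ℝ).mono fun p hp h0 =>
      hp (by simp [h0])
  have hflux_zero {t y : ℝ} (hy : y = y₀ ∨ y = y₁) : relFlux f η q u φ (t, χ t y) = 0 := by
    rw [relFlux, hφ.eq_zero, zero_mul]
    rcases hy with rfl | rfl
    exacts [fun hp => hp.2.1.false, fun hp => hp.2.2.false]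
  have hends (t : ℝ) : χ t y₀ ≤ χ t y₁ := hS.monotone t hS.param_le
  rw [integral_eq_integral_between hint hS.time_le hends fun p hp => by
      simp [hφ.fderiv_eq_zero hp],
    integral_eq_integral_between hφ.integrable_abs hS.time_le hends fun p hp => by
      simp [hφ.eq_zero hp]]
  simpa [sliceBalance, hflux_zero] using hS.abs_integral_sliceBalance_le hf h hc
    hφ.contDiff_one hφ.compact (fun x => hφ.eq_zero fun hp => hp.1.1.false)
    fun x => hφ.eq_zero fun hp => hp.1.2.false

end IsCharacteristicStrip

/-! ### Mollification -/

section Mollifier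

variable (E : Type*) [NormedAddCommGroup E]

/-- The bumps at the origin of radius `1 / (n + 1)`, which give a sequence of mollifiers. -/
noncomputable def shrinkingBump (n : ℕ) : ContDiffBump (0 : E) where
  rIn := 1 / (n + 1) / 2
  rOut := 1 / (n + 1)
  rIn_pos := by positivity
  rIn_lt_rOut := half_lt_self (by positivity)

lemma tendsto_rOut_shrinkingBump :
    Filter.Tendsto (fun n => (shrinkingBump E n).rOut) Filter.atTop (𝓝 0) :=
  tendsto_one_div_add_atTop_nhds_zero_nat

variable {E} [NormedSpace ℝ E] [FiniteDimensional ℝ E] [MeasurableSpace E] [BorelSpace E]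
  {μ : Measure E} [μ.IsAddHaarMeasure]

lemma isTestFunction_normed_sub (ρ : ContDiffBump (0 : E)) {Ω : Set E} {x : E}
    (hx : Metric.closedBall x ρ.rOut ⊆ Ω) : IsTestFunction Ω fun y => ρ.normed μ (x - y) := by
  have hzero : ∀ y ∉ Metric.closedBall x ρ.rOut, ρ.normed μ (x - y) = 0 := fun y hy => by
    rw [← Function.notMem_support, ρ.support_normed_eq]
    rw [Metric.mem_closedBall, dist_comm, dist_eq_norm] at hy
    exact fun h => hy (mem_ball_zero_iff.1 h).le
  exact ⟨ρ.contDiff_normed.comp (contDiff_const.sub contDiff_id),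
    HasCompactSupport.intro (isCompact_closedBall x ρ.rOut) hzero,
    (closure_minimal (Function.support_subset_iff'.2 hzero) Metric.isClosed_closedBall).trans hx⟩

lemma integral_normed_sub (ρ : ContDiffBump (0 : E)) (x : E) :
    ∫ y, ρ.normed μ (x - y) ∂μ = 1 := by
  rw [integral_sub_left_eq_self, ρ.integral_normed]

lemma abs_setIntegral_normed_mul_le (ρ : ContDiffBump (0 : E)) {T : Set E} {h : E → ℝ} {K : ℝ}
    (hK : 0 ≤ K) (h_le : ∀ᵐ y ∂(μ.restrict T), |h y| ≤ K) (x : E) :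
    |∫ y in T, ρ.normed μ (x - y) * h y ∂μ| ≤ K := by
  have hint : Integrable (fun y => ρ.normed μ (x - y)) μ := ρ.integrable_normed.comp_sub_left x
  calc |∫ y in T, ρ.normed μ (x - y) * h y ∂μ|
      ≤ ∫ y in T, ρ.normed μ (x - y) * K ∂μ := by
        rw [← Real.norm_eq_abs]
        refine norm_integral_le_of_norm_le (hint.mul_const _).integrableOn ?_
        filter_upwards [h_le] with y hy
        rw [norm_mul, Real.norm_of_nonneg (ρ.nonneg_normed _)]
        exact mul_le_mul_of_nonneg_left hy (ρ.nonneg_normed _)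
    _ ≤ ∫ y, ρ.normed μ (x - y) * K ∂μ :=
        setIntegral_le_integral (hint.mul_const _)
          (ae_of_all _ fun y => mul_nonneg (ρ.nonneg_normed _) hK)
    _ = K := by rw [integral_mul_const, integral_normed_sub, one_mul]

lemma ae_abs_le_of_abs_integral_le {Ω : Set E} (hΩ : IsOpen Ω) {g : E → ℝ}
    (hg : LocallyIntegrable g μ) {K : ℝ}
    (h : ∀ φ, IsTestFunction Ω φ → |∫ x, φ x * g x ∂μ| ≤ K * ∫ x, |φ x| ∂μ) :
    ∀ᵐ x ∂(μ.restrict Ω), |g x| ≤ K := by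
  have hconv := ContDiffBump.ae_convolution_tendsto_right_of_locallyIntegrable (μ := μ) (K := 2)
    (tendsto_rOut_shrinkingBump E) (.of_forall fun n => by dsimp only [shrinkingBump]; linarith) hg
  refine (ae_restrict_iff' hΩ.measurableSet).2 ?_
  filter_upwards [hconv] with x hx hxΩ
  obtain ⟨r, hr, hball⟩ := Metric.isOpen_iff.1 hΩ x hxΩ
  refine le_of_tendsto hx.abs ?_
  filter_upwards [(tendsto_rOut_shrinkingBump E).eventually (gt_mem_nhds hr)] with n hn
  have hbound := h _ (isTestFunction_normed_sub (μ := μ) (shrinkingBump E n)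
    ((Metric.closedBall_subset_ball hn).trans hball))
  simp only [abs_of_nonneg ((shrinkingBump E n).nonneg_normed _)] at hbound
  rw [integral_normed_sub, mul_one] at hbound
  rwa [convolution_eq_swap]

end Mollifier

namespace DistribDeriv

open ContinuousLinearMap Convolution

variable {T : Set ℝ} {v h w : ℝ → ℝ}

lemma hasDerivAt_normed_convolution (hd : DistribDeriv T v h) (ρ : ContDiffBump (0 : ℝ)) {x : ℝ}
    (hx : Metric.closedBall x ρ.rOut ⊆ T) (hw : LocallyIntegrable w)
    (hwv : EqOn w v (Metric.closedBall x ρ.rOut)) :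
    HasDerivAt (ρ.normed volume ⋆[lsmul ℝ ℝ] w) (∫ y in T, ρ.normed volume (x - y) * h y) x := by
  have hρ : ContDiff ℝ ∞ (ρ.normed volume) := ρ.contDiff_normed
  refine (ρ.hasCompactSupport_normed.hasDerivAt_convolution_left _ (hρ.of_le (by norm_num)) hw
    x).congr_deriv ?_
  have htest := isTestFunction_normed_sub (μ := volume) ρ
    (subset_refl (Metric.closedBall x ρ.rOut))
  have hderiv (y : ℝ) : deriv (fun y => ρ.normed volume (x - y)) y
      = -deriv (ρ.normed volume) (x - y) := deriv_comp_const_sub _ _ _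
  have hderiv_zero : ∀ y ∉ Metric.closedBall x ρ.rOut, deriv (ρ.normed volume) (x - y) = 0 :=
    fun y hy => by
      rw [← neg_eq_zero, ← hderiv, ← fderiv_apply_one_eq_deriv, htest.fderiv_eq_zero hy]
      rfl
  rw [← hd _ (htest.mono hx), convolution_eq_swap, ← integral_neg,
    setIntegral_eq_integral_of_forall_compl_eq_zero fun y hy => by
      simp [hderiv, hderiv_zero y fun h => hy (hx h)]]
  congr with y
  by_cases hy : y ∈ Metric.closedBall x ρ.rOut
  · simp [hderiv, hwv hy]
  · simp [hderiv, hderiv_zero y hy]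

lemma lipschitzOnWith (hd : DistribDeriv T v h) (hT : IsOpen T) (hv : ContinuousOn v T) {G : ℝ≥0}
    (hG : ∀ᵐ t ∂(volume.restrict T), |h t| ≤ G) {a b : ℝ} (hab : Icc a b ⊆ T) :
    LipschitzOnWith G v (Icc a b) := by
  obtain ⟨r, hr, hrT⟩ := isCompact_Icc.exists_cthickening_subset_open hT hab
  set K := Metric.cthickening r (Icc a b)
  have hball {x : ℝ} (hx : x ∈ Icc a b) : Metric.closedBall x r ⊆ K :=
    Metric.closedBall_subset_cthickening hx r
  have hK : IsCompact K := isCompact_Icc.cthickening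
  have hw : LocallyIntegrable (K.indicator v) :=
    (((hv.mono hrT).integrableOn_compact hK).integrable_indicator
      hK.measurableSet).locallyIntegrable
  have hwv : EqOn (K.indicator v) v K := fun x hx => indicator_of_mem hx v
  have hlim {x : ℝ} (hx : x ∈ Icc a b) : Filter.Tendsto (fun n =>
      ((shrinkingBump ℝ n).normed volume ⋆[lsmul ℝ ℝ] K.indicator v) x) Filter.atTop (𝓝 (v x)) := by
    have hKx : K ∈ 𝓝 x := Filter.mem_of_superset (Metric.closedBall_mem_nhds x hr) (hball hx)
    have hcont : ContinuousAt (K.indicator v) x := (hv.continuousAt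
      (hT.mem_nhds (hab hx))).congr (hwv.symm.eventuallyEq_of_mem hKx)
    rw [← hwv (hball hx (Metric.mem_closedBall_self hr.le))]
    exact ContDiffBump.convolution_tendsto_right (tendsto_rOut_shrinkingBump ℝ)
      (.of_forall fun _ => hw.aestronglyMeasurable)
      (hcont.tendsto.comp Filter.tendsto_snd) tendsto_const_nhds
  refine LipschitzOnWith.of_dist_le_mul fun s hs t ht =>
    le_of_tendsto ((hlim hs).dist (hlim ht)) ?_
  filter_upwards [(tendsto_rOut_shrinkingBump ℝ).eventually (gt_mem_nhds hr)] with n hn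
  have hsub {x : ℝ} (hx : x ∈ Icc a b) :
      Metric.closedBall x (shrinkingBump ℝ n).rOut ⊆ K :=
    (Metric.closedBall_subset_closedBall hn.le).trans (hball hx)
  exact (convex_Icc a b).norm_image_sub_le_of_norm_hasDerivWithin_le (fun x hx =>
    (hd.hasDerivAt_normed_convolution (shrinkingBump ℝ n) ((hsub hx).trans hrT) hw
      (hwv.mono (hsub hx))).hasDerivWithinAt)
    (fun x _ => abs_setIntegral_normed_mul_le (shrinkingBump ℝ n) G.2 hG x) ht hs

end DistribDeriv

/-! ### Distributions bounded in `L¹` -/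

section TestFunctions

variable {E : Type*} [NormedAddCommGroup E] [NormedSpace ℝ E] {Ω : Set E}

/-- The space `C_c^∞(Ω)` of test functions, on which distributions are linear functionals. -/
def testFunctions (Ω : Set E) : Submodule ℝ (E → ℝ) where
  carrier := {φ | IsTestFunction Ω φ}
  add_mem' := IsTestFunction.add
  zero_mem' := IsTestFunction.zero Ω
  smul_mem' r _ h := h.const_smul r

variable [FiniteDimensional ℝ E]

lemma exists_sum_eq_of_mem_nhds (φ : testFunctions Ω) {V : Ω → Set E}
    (hV : ∀ p : Ω, V p ∈ 𝓝 p.1) :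
    ∃ (S : Finset Ω) (ψ : Ω → testFunctions Ω), (∀ p, IsTestFunction (V p) (ψ p).1) ∧
      ∑ p ∈ S, ψ p = φ ∧ ∀ x, ∑ p ∈ S, |(ψ p).1 x| = |φ.1 x| := by
  have hφ : IsTestFunction Ω φ.1 := φ.2
  obtain ⟨ρ, hρ⟩ := SmoothPartitionOfUnity.exists_isSubordinate (modelWithCornersSelf ℝ E)
    (isClosed_tsupport φ.1) (fun p => interior (V p)) (fun _ => isOpen_interior)
    fun x hx => mem_iUnion.2
      ⟨⟨x, hφ.supp hx⟩, mem_interior_iff_mem_nhds.2 (hV ⟨x, hφ.supp hx⟩)⟩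
  have hfin := ρ.locallyFinite.finite_nonempty_inter_compact hφ.compact
  have hsmooth (p : Ω) : ContDiff ℝ ∞ fun x => ρ p x * φ.1 x :=
    (ρ p).contMDiff.contDiff.mul hφ.smooth
  have hone (x : E) : φ.1 x = 0 ∨ ∑ p ∈ hfin.toFinset, ρ p x = 1 := by
    refine or_iff_not_imp_left.2 fun hx => ?_
    rw [← finsum_eq_sum_of_support_subset _ fun p hp =>
      hfin.mem_toFinset.2 ⟨x, hp, subset_tsupport _ hx⟩, ρ.sum_eq_one (subset_tsupport _ hx)]
  refine ⟨hfin.toFinset, fun p => ⟨fun x => ρ p x * φ.1 x, hsmooth p, hφ.compact.mul_left,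
      tsupport_mul_subset_right.trans hφ.supp⟩, fun p => ⟨hsmooth p, hφ.compact.mul_left,
      tsupport_mul_subset_left.trans ((hρ p).trans interior_subset)⟩, ?_, fun x => ?_⟩
  · ext x
    rcases hone x with hx | hx <;> simp [← Finset.sum_mul, hx]
  · rcases hone x with hx | hx <;>
      simp [abs_mul, abs_of_nonneg (ρ.nonneg _ x), ← Finset.sum_mul, hx]

lemma abs_le_of_locally_abs_le [MeasurableSpace E] [OpensMeasurableSpace E] (μ : Measure E)
    [IsFiniteMeasureOnCompacts μ] {L : testFunctions Ω →ₗ[ℝ] ℝ} {K : ℝ}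
    (hloc : ∀ p ∈ Ω, ∃ V ∈ 𝓝 p, ∀ φ : testFunctions Ω, IsTestFunction V φ.1 →
      |L φ| ≤ K * ∫ x, |φ.1 x| ∂μ)
    (φ : testFunctions Ω) : |L φ| ≤ K * ∫ x, |φ.1 x| ∂μ := by
  choose V hV hVL using fun p : Ω => hloc p p.2
  obtain ⟨S, ψ, hψV, hψ, hψabs⟩ := exists_sum_eq_of_mem_nhds φ hV
  calc |L φ| = |∑ p ∈ S, L (ψ p)| := by rw [← map_sum, hψ]
    _ ≤ ∑ p ∈ S, K * ∫ x, |(ψ p).1 x| ∂μ :=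
        (Finset.abs_sum_le_sum_abs _ _).trans (Finset.sum_le_sum fun p _ => hVL p _ (hψV p))
    _ = K * ∫ x, |φ.1 x| ∂μ := by
        rw [← Finset.mul_sum, ← integral_finsetSum S fun p _ => (ψ p).2.integrable_abs]
        simp only [hψabs]

end TestFunctions

lemma exists_eq_inner_of_abs_le {V H : Type*} [AddCommGroup V] [Module ℝ V] [NormedAddCommGroup H]
    [InnerProductSpace ℝ H] [CompleteSpace H] (j : V →ₗ[ℝ] H) (T : V →ₗ[ℝ] ℝ) {C : ℝ}
    (hT : ∀ v, |T v| ≤ C * ‖j v‖) : ∃ h : H, ∀ v, T v = inner ℝ h (j v) := by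
  have hker : LinearMap.ker j ≤ LinearMap.ker T := fun v hv => by
    have hTv := hT v
    rw [LinearMap.mem_ker.1 hv, norm_zero, mul_zero] at hTv
    exact LinearMap.mem_ker.2 (abs_nonpos_iff.1 hTv)
  let T' : LinearMap.range j →ₗ[ℝ] ℝ :=
    (LinearMap.ker j).liftQ T hker ∘ₗ j.quotKerEquivRange.symm.toLinearMap
  have hT' (v : V) : T' ⟨j v, LinearMap.mem_range_self j v⟩ = T v := by
    have : j.quotKerEquivRange.symm ⟨j v, LinearMap.mem_range_self j v⟩ =
        Submodule.Quotient.mk v := (LinearEquiv.symm_apply_eq _).2 rfl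
    simp [T', this]
  obtain ⟨g, hg, -⟩ := exists_extension_norm_eq (LinearMap.range j) (T'.mkContinuous C (by
    rintro ⟨_, v, rfl⟩
    rw [hT']
    exact hT v))
  refine ⟨(InnerProductSpace.toDual ℝ H).symm g, fun v => ?_⟩
  rw [InnerProductSpace.toDual_symm_apply, ← hT']
  exact (hg ⟨j v, LinearMap.mem_range_self j v⟩).symm

section Riesz

variable {E : Type*} [NormedAddCommGroup E] [NormedSpace ℝ E] [MeasurableSpace E] [BorelSpace E]
  {μ : Measure E} {Ω : Set E}

lemma exists_continuous_pos_memLp_two [FiniteDimensional ℝ E] (μ : Measure E)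
    [μ.IsAddHaarMeasure] : ∃ w : E → ℝ, Continuous w ∧ (∀ x, 0 < w x) ∧ MemLp w 2 μ := by
  have hpos (x : E) : 0 < 1 + ‖x‖ := by positivity
  set d : ℝ := Module.finrank ℝ E + 1
  have hw : Continuous fun x : E => (1 + ‖x‖) ^ (-(d / 2)) :=
    (by fun_prop : Continuous fun x : E => 1 + ‖x‖).rpow_const fun x => Or.inl (hpos x).ne'
  refine ⟨_, hw, fun x => Real.rpow_pos_of_pos (hpos x) _, ?_⟩
  rw [memLp_two_iff_integrable_sq hw.aestronglyMeasurable]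
  convert integrable_one_add_norm (μ := μ) (lt_add_one (Module.finrank ℝ E : ℝ)) using 2 with x
  rw [← Real.rpow_natCast, ← Real.rpow_mul (hpos x).le]
  congr 1
  push_cast
  ring

section Embedding

variable [IsFiniteMeasureOnCompacts μ] {w : E → ℝ}

lemma IsTestFunction.memLp_div {φ : E → ℝ} (hφ : IsTestFunction Ω φ) (hw : Continuous w)
    (hw₀ : ∀ x, 0 < w x) : MemLp (fun x => φ x / w x) 2 μ := by
  have hcont : Continuous fun x => φ x / w x :=
    hφ.smooth.continuous.div hw fun x => (hw₀ x).ne'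
  exact hcont.memLp_of_hasCompactSupport <| hφ.compact.mono fun x hx h0 => hx (by simp [h0])

/-- The embedding `φ ↦ φ / w` of the test functions into `L²`. For a weight `w ∈ L²` its norm
dominates the `L¹` norm of `φ`. -/
noncomputable def divToLp (Ω : Set E) (μ : Measure E) [IsFiniteMeasureOnCompacts μ]
    (hw : Continuous w) (hw₀ : ∀ x, 0 < w x) : testFunctions Ω →ₗ[ℝ] Lp ℝ 2 μ where
  toFun φ := (φ.2.memLp_div hw hw₀).toLp _
  map_add' φ ψ := by
    rw [← MemLp.toLp_add]
    congr 1
    ext x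
    exact add_div _ _ _
  map_smul' r φ := by
    rw [RingHom.id_apply, ← MemLp.toLp_const_smul]
    congr 1
    ext x
    exact mul_div_assoc _ _ _

lemma inner_divToLp (hw : Continuous w) (hw₀ : ∀ x, 0 < w x) (F : Lp ℝ 2 μ)
    (φ : testFunctions Ω) : inner ℝ F (divToLp Ω μ hw hw₀ φ) = ∫ x, φ.1 x * (F x / w x) ∂μ := by
  rw [L2.inner_def]
  refine integral_congr_ae ?_
  filter_upwards [(φ.2.memLp_div (μ := μ) hw hw₀).coeFn_toLp] with x hx
  change inner ℝ (F x) ((φ.2.memLp_div hw hw₀).toLp _ x) = _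
  rw [hx, RCLike.inner_apply, conj_trivial, div_mul_eq_mul_div, mul_div_assoc]

lemma integral_abs_le_norm_mul_norm_divToLp (hw : Continuous w) (hw₀ : ∀ x, 0 < w x)
    (hw₂ : MemLp w 2 μ) (φ : testFunctions Ω) :
    ∫ x, |φ.1 x| ∂μ ≤ ‖hw₂.toLp w‖ * ‖divToLp Ω μ hw hw₀ φ‖ := by
  have habs := (φ.2.memLp_div (μ := μ) hw hw₀).abs
  have hnorm : ‖habs.toLp _‖ = ‖divToLp Ω μ hw hw₀ φ‖ := by
    change _ = ‖(φ.2.memLp_div hw hw₀).toLp _‖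
    rw [Lp.norm_toLp, Lp.norm_toLp]
    exact congrArg _ (eLpNorm_norm fun x => φ.1 x / w x)
  rw [← hnorm]
  refine le_trans (le_of_eq ?_) (real_inner_le_norm (hw₂.toLp w) (habs.toLp _))
  rw [L2.inner_def]
  refine integral_congr_ae ?_
  filter_upwards [hw₂.coeFn_toLp, habs.coeFn_toLp] with x hwx hx
  rw [hwx, hx, RCLike.inner_apply, conj_trivial, Pi.abs_apply, abs_div, abs_of_pos (hw₀ x),
    div_mul_cancel₀ _ (hw₀ x).ne']

end Embedding

/-- `L¹`–`L^∞` duality, obtained from the Riesz representation theorem in a weighted `L²`. -/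
lemma exists_eq_integral_of_abs_le [FiniteDimensional ℝ E] [μ.IsAddHaarMeasure]
    (hΩ : IsOpen Ω) (L : testFunctions Ω →ₗ[ℝ] ℝ) {K : ℝ≥0}
    (hL : ∀ φ : testFunctions Ω, |L φ| ≤ K * ∫ x, |φ.1 x| ∂μ) :
    ∃ g : E → ℝ, LocallyIntegrable g μ ∧ (∀ᵐ x ∂(μ.restrict Ω), |g x| ≤ K) ∧
      ∀ φ : testFunctions Ω, L φ = ∫ x, φ.1 x * g x ∂μ := by
  obtain ⟨w, hw, hw₀, hw₂⟩ := exists_continuous_pos_memLp_two μ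
  obtain ⟨F, hF⟩ := exists_eq_inner_of_abs_le (divToLp Ω μ hw hw₀) L
    (C := K * ‖hw₂.toLp w‖) fun φ => by
      rw [mul_assoc]
      exact (hL φ).trans (mul_le_mul_of_nonneg_left
        (integral_abs_le_norm_mul_norm_divToLp hw hw₀ hw₂ φ) K.2)
  simp only [inner_divToLp] at hF
  have hloc : LocallyIntegrable (fun x => F x / w x) μ := by
    simp only [div_eq_inv_mul]
    exact ((Lp.memLp F).locallyIntegrable one_le_two).continuous_mul
      (hw.inv₀ fun x => (hw₀ x).ne')
  refine ⟨_, hloc, ae_abs_le_of_abs_integral_le hΩ hloc fun φ hφ => ?_, hF⟩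
  exact hF ⟨φ, hφ⟩ ▸ hL ⟨φ, hφ⟩

end Riesz

/-! ### Lagrangian solutions -/

namespace IsLagrangianParam

variable {f : ℝ → ℝ} {Ω N : Set (ℝ × ℝ)} {u : ℝ × ℝ → ℝ} {χ : ℝ → ℝ → ℝ}

lemma continuousOn_curve (hχ : IsLagrangianParam f Ω u χ) (y : ℝ) :
    ContinuousOn (fun t => χ t y) (Ioi 0) :=
  hχ.continuousOn.comp (f := fun t : ℝ => (t, y)) (by fun_prop) fun _ ht => ⟨ht, mem_univ _⟩

lemma isOpen_curveTimes (hχ : IsLagrangianParam f Ω u χ) (hΩ : IsOpen Ω)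
    (hΩ_sub : Ω ⊆ halfPlane) (y : ℝ) : IsOpen (curveTimes Ω fun t => χ t y) := by
  convert (continuousOn_id.prodMk (hχ.continuousOn_curve y)).isOpen_inter_preimage isOpen_Ioi hΩ
    using 1
  exact (inter_eq_right.2 fun t (ht : (t, χ t y) ∈ Ω) => (hΩ_sub ht).1).symm

lemma exists_openStrip (hχ : IsLagrangianParam f Ω u χ) {p : ℝ × ℝ} (hp : 0 < p.1)
    (hN : N ∈ 𝓝 p) :
    ∃ a b y₀ y₁, 0 < a ∧ y₀ ≤ y₁ ∧ p ∈ openStrip χ a b y₀ y₁ ∧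
      ∀ t ∈ Icc a b, ∀ y ∈ Icc y₀ y₁, (t, χ t y) ∈ N := by
  obtain ⟨t₀, x₀⟩ := p
  obtain ⟨r, hr, hrN⟩ := Metric.mem_nhds_iff.1 hN
  obtain ⟨y₀, hy₀⟩ := hχ.surjective t₀ hp (x₀ - r / 2)
  obtain ⟨y₁, hy₁⟩ := hχ.surjective t₀ hp (x₀ + r / 2)
  have hmono : Monotone (χ t₀) := hχ.monotone t₀ hp
  have hy : y₀ < y₁ := hmono.reflect_lt (by linarith)
  have hball : ∀ y ∈ Icc y₀ y₁, (t₀, χ t₀ y) ∈ Metric.ball (t₀, x₀) r := fun y hy => by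
    rw [← ball_prod_same]
    refine ⟨Metric.mem_ball_self hr, Metric.mem_ball.2 (abs_lt.2 ⟨?_, ?_⟩)⟩ <;>
      linarith [hmono hy.1, hmono hy.2]
  have hnear : ∀ᶠ t in 𝓝 t₀, 0 < t ∧ ∀ y ∈ Icc y₀ y₁, (t, χ t y) ∈ Metric.ball (t₀, x₀) r := by
    refine (lt_mem_nhds hp).and (isCompact_Icc.eventually_forall_of_forall_eventually
      fun y hy => ?_)
    have hcont : ContinuousAt (fun z : ℝ × ℝ => (z.1, χ z.1 z.2)) (t₀, y) :=
      continuousAt_fst.prodMk (hχ.continuousOn.continuousAt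
        ((isOpen_Ioi.prod isOpen_univ).mem_nhds ⟨hp, mem_univ _⟩))
    exact hcont.eventually (Metric.isOpen_ball.mem_nhds (hball y hy))
  obtain ⟨l, hl, hlnear⟩ := Metric.nhds_basis_closedBall.mem_iff.1 hnear
  rw [Real.closedBall_eq_Icc] at hlnear
  refine ⟨t₀ - l, t₀ + l, y₀, y₁, (hlnear (left_mem_Icc.2 (by linarith))).1, hy.le,
    ⟨⟨by linarith, by linarith⟩, ?_⟩, fun t ht y hy => hrN ((hlnear ht).2 y hy)⟩
  rw [hy₀, hy₁]
  constructor <;> linarith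

end IsLagrangianParam

lemma exists_continuous_eqOn {X : Type*} [TopologicalSpace X] [NormalSpace X] {s : Set X}
    (hs : IsClosed s) {u : X → ℝ} (hu : ContinuousOn u s) :
    ∃ v : X → ℝ, Continuous v ∧ EqOn v u s := by
  obtain ⟨v, hv⟩ := ContinuousMap.exists_restrict_eq hs ⟨s.domRestrict u, hu.domRestrict⟩
  exact ⟨v, v.continuous, fun x hx => congrArg (fun w => w ⟨x, hx⟩) hv⟩

namespace IsLagrangianSolution

variable {f : ℝ → ℝ} {Ω N : Set (ℝ × ℝ)} {u gL : ℝ × ℝ → ℝ} {χ : ℝ → ℝ → ℝ} {G : ℝ≥0}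
  {p : ℝ × ℝ}

lemma lipschitzOnWith (hu : IsLagrangianSolution f Ω u χ gL) (hΩ : IsOpen Ω)
    (hΩ_sub : Ω ⊆ halfPlane) (hG : LagrangianSourceBound Ω χ gL G) {a b y : ℝ}
    (h : ∀ t ∈ Icc a b, (t, χ t y) ∈ Ω) :
    LipschitzOnWith G (fun t => u (t, χ t y)) (Icc a b) :=
  (hu.deriv_eq y).lipschitzOnWith (hu.param.isOpen_curveTimes hΩ hΩ_sub y)
    (hu.continuousOn.comp ((continuousOn_id.prodMk (hu.param.continuousOn_curve y)).mono
      fun _ ht => (hΩ_sub ht).1) fun _ ht => ht) (hG y) h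

lemma exists_isCharacteristicStrip (hu : IsLagrangianSolution f Ω u χ gL) (hΩ : IsOpen Ω)
    (hΩ_sub : Ω ⊆ halfPlane) (hG : LagrangianSourceBound Ω χ gL G) (hp : p ∈ Ω) (hN : N ∈ 𝓝 p) :
    ∃ v ξ a b y₀ y₁, IsCharacteristicStrip f v ξ G a b y₀ y₁ ∧ p ∈ openStrip ξ a b y₀ y₁ ∧
      ∀ t ∈ Icc a b, ∀ y ∈ Icc y₀ y₁, (t, ξ t y) ∈ N ∧ v (t, ξ t y) = u (t, ξ t y) := by
  obtain ⟨a, b, y₀, y₁, ha, hy, hp', hstrip⟩ := hu.param.exists_openStrip (hΩ_sub hp).1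
    (Filter.inter_mem hN (hΩ.mem_nhds hp))
  have hpos (t : ℝ) : 0 < max (a / 2) t := lt_max_of_lt_left (half_pos ha)
  set ξ : ℝ → ℝ → ℝ := fun t => χ (max (a / 2) t)
  have hξχ {t : ℝ} (ht : a / 2 ≤ t) : ξ t = χ t := congrArg χ (max_eq_right ht)
  have hξ_Icc {t : ℝ} (ht : t ∈ Icc a b) : ξ t = χ t := hξχ (by linarith [ht.1])
  have hcont : Continuous fun p : ℝ × ℝ => ξ p.1 p.2 :=
    hu.param.continuousOn.comp_continuous (f := fun p : ℝ × ℝ => (max (a / 2) p.1, p.2))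
      (by fun_prop) fun p => ⟨hpos p.1, mem_univ _⟩
  have hstrip' : ∀ t ∈ Icc a b, ∀ y ∈ Icc y₀ y₁, (t, ξ t y) ∈ N ∩ Ω := fun t ht => by
    rw [hξ_Icc ht]
    exact hstrip t ht
  set K := (fun p : ℝ × ℝ => (p.1, ξ p.1 p.2)) '' Icc a b ×ˢ Icc y₀ y₁
  have hK : IsCompact K :=
    (isCompact_Icc.prod isCompact_Icc).image (continuous_fst.prodMk hcont)
  have hKΩ : K ⊆ Ω := by
    rintro _ ⟨⟨t, y⟩, ⟨ht, hy⟩, rfl⟩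
    exact (hstrip' t ht y hy).2
  obtain ⟨v, hv, hvu⟩ := exists_continuous_eqOn hK.isClosed (hu.continuousOn.mono hKΩ)
  have hvu' : ∀ t ∈ Icc a b, ∀ y ∈ Icc y₀ y₁, v (t, ξ t y) = u (t, ξ t y) :=
    fun t ht y hy => hvu ⟨(t, y), ⟨ht, hy⟩, rfl⟩
  refine ⟨v, ξ, a, b, y₀, y₁, ⟨(hp'.1.1.trans hp'.1.2).le, hy, hv, hcont,
    fun t => hu.param.monotone _ (hpos t), fun t ht y hy => ?_, fun y hy => ?_⟩, ?_,
    fun t ht y hy => ⟨(hstrip' t ht y hy).1, hvu' t ht y hy⟩⟩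
  · rw [hvu' t ht y hy, hξ_Icc ht]
    refine (hu.param.characteristic y t (hstrip t ht y hy).2).congr_of_eventuallyEq ?_
    filter_upwards [lt_mem_nhds (by linarith [ht.1] : a / 2 < t)] with s hs
    rw [hξχ hs.le]
  · intro s hs t ht
    beta_reduce
    rw [hvu' s hs y hy, hvu' t ht y hy, hξ_Icc hs, hξ_Icc ht]
    exact hu.lipschitzOnWith hΩ hΩ_sub hG (fun t ht => (hstrip t ht y hy).2) hs ht
  · rwa [openStrip, mem_ofPred, hξ_Icc (Ioo_subset_Icc_self hp'.1)]

lemma exists_nhds_abs_integral_le (hu : IsLagrangianSolution f Ω u χ gL) (hf : ContDiff ℝ 1 f)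
    (hΩ : IsOpen Ω) (hΩ_sub : Ω ⊆ halfPlane) (hG : LagrangianSourceBound Ω χ gL G) (hp : p ∈ Ω)
    (hN : N ∈ 𝓝 p) :
    ∃ V ∈ 𝓝 p, ∀ {η q : ℝ → ℝ} {c : ℝ≥0}, IsEntropyPair f η q →
      (∀ x ∈ N, |deriv η (u x)| ≤ c) → ∀ φ, IsTestFunction V φ →
        |∫ x, fderiv ℝ φ x (η (u x), q (u x))| ≤ c * G * ∫ x, |φ x| := by
  obtain ⟨v, ξ, a, b, y₀, y₁, hS, hpS, hstrip⟩ :=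
    hu.exists_isCharacteristicStrip hΩ hΩ_sub hG hp hN
  refine ⟨_, hS.isOpen_openStrip.mem_nhds hpS, fun {η q c} h hc φ hφ => ?_⟩
  have hvu : EqOn v u (openStrip ξ a b y₀ y₁) :=
    hS.openStrip_subset (N := {x | v x = u x}) fun t ht y hy => (hstrip t ht y hy).2
  convert hS.abs_integral_fderiv_apply_pair_le hf h (fun t ht y hy => ?_) hφ using 4 with x
  · by_cases hx : x ∈ openStrip ξ a b y₀ y₁
    · rw [hvu hx]
    · simp [hφ.fderiv_eq_zero hx]
  · rw [(hstrip t ht y hy).2]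
    exact hc _ (hstrip t ht y hy).1

end IsLagrangianSolution

section Distributions

variable {E : Type*} [NormedAddCommGroup E] [NormedSpace ℝ E] [MeasurableSpace E] [BorelSpace E]
  {μ : Measure E} {Ω V : Set E} {φ h : E → ℝ} {F : E → E} {K : ℝ}

namespace IsTestFunction

lemma abs_integral_mul_le [IsFiniteMeasureOnCompacts μ] (hφ : IsTestFunction V φ)
    (hh : ∀ᵐ x ∂μ, x ∈ V → |h x| ≤ K) :
    |∫ x, φ x * h x ∂μ| ≤ K * ∫ x, |φ x| ∂μ := by
  rw [← Real.norm_eq_abs, ← integral_const_mul]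
  refine norm_integral_le_of_norm_le (hφ.integrable_abs.const_mul K) ?_
  filter_upwards [hh] with x hx
  rw [norm_mul, mul_comm, Real.norm_eq_abs, Real.norm_eq_abs]
  by_cases hxV : x ∈ V
  · exact mul_le_mul_of_nonneg_right (hx hxV) (abs_nonneg _)
  · simp [hφ.eq_zero hxV]

lemma integrable_mul (hφ : IsTestFunction Ω φ) (hh : LocallyIntegrableOn h Ω μ) :
    Integrable (fun x => φ x * h x) μ := by
  rw [← integrableOn_iff_integrable_of_support_subset (s := tsupport φ) fun x hx =>
    subset_tsupport φ (left_ne_zero_of_mul hx)]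
  exact (hh.integrableOn_compact_subset hφ.supp hφ.compact).continuousOn_mul
    hφ.smooth.continuous.continuousOn hφ.compact

lemma integrable_fderiv_apply [IsFiniteMeasureOnCompacts μ] (hφ : IsTestFunction Ω φ)
    (hF : ContinuousOn F Ω) : Integrable (fun x => fderiv ℝ φ x (F x)) μ := by
  have hsupp : Function.support (fun x => fderiv ℝ φ x (F x)) ⊆ tsupport φ := fun x hx =>
    tsupport_fderiv_subset ℝ (subset_tsupport _ fun h0 => hx (by simp [h0]))
  rw [← integrableOn_iff_integrable_of_support_subset hsupp]
  exact ((hφ.contDiff_one.continuous_fderiv one_ne_zero).continuousOn.clm_apply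
    (hF.mono hφ.supp)).integrableOn_compact hφ.compact

end IsTestFunction

/-- The locally integrable function `h`, as a distribution on `Ω`. -/
noncomputable def distribOfFun (hh : LocallyIntegrableOn h Ω μ) : testFunctions Ω →ₗ[ℝ] ℝ where
  toFun φ := ∫ x, φ.1 x * h x ∂μ
  map_add' φ ψ := by
    simp only [Submodule.coe_add, Pi.add_apply, add_mul]
    exact integral_add (φ.2.integrable_mul hh) (ψ.2.integrable_mul hh)
  map_smul' r φ := by
    simp only [Submodule.coe_smul, Pi.smul_apply, smul_eq_mul, mul_assoc, RingHom.id_apply]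
    exact integral_const_mul _ _

/-- The divergence of the continuous field `F`, as a distribution on `Ω`. For `F = (a, b)` on the
plane this is `∂ₜ a + ∂ₓ b`. -/
noncomputable def distribDivergence (μ : Measure E) [IsFiniteMeasureOnCompacts μ]
    (hF : ContinuousOn F Ω) : testFunctions Ω →ₗ[ℝ] ℝ where
  toFun φ := -∫ x, fderiv ℝ φ.1 x (F x) ∂μ
  map_add' φ ψ := by
    rw [← neg_add, ← integral_add (φ.2.integrable_fderiv_apply hF)
      (ψ.2.integrable_fderiv_apply hF)]
    congr with x
    rw [Submodule.coe_add, fderiv_add (φ.2.contDiff_one.differentiable one_ne_zero x)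
      (ψ.2.contDiff_one.differentiable one_ne_zero x)]
    rfl
  map_smul' r φ := by
    rw [RingHom.id_apply, smul_eq_mul, mul_neg, ← integral_const_mul]
    congr with x
    rw [Submodule.coe_smul, fderiv_const_smul_field]
    rfl

end Distributions

lemma distribBalance_iff {Ω : Set (ℝ × ℝ)} {a b h : ℝ × ℝ → ℝ}
    (hF : ContinuousOn (fun p => (a p, b p)) Ω) (hh : LocallyIntegrableOn h Ω) :
    DistribBalance Ω a b h ↔ distribDivergence volume hF = distribOfFun hh := by
  have hfderiv (φ : ℝ × ℝ → ℝ) (p : ℝ × ℝ) :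
      fderiv ℝ φ p (1, 0) * a p + fderiv ℝ φ p (0, 1) * b p = fderiv ℝ φ p (a p, b p) := by
    rw [mul_comm, mul_comm _ (b p), ← smul_eq_mul, ← smul_eq_mul, ← map_smul, ← map_smul,
      ← map_add]
    simp
  have hiff (φ : testFunctions Ω) : distribDivergence volume hF φ = distribOfFun hh φ ↔
      -∫ p in Ω, (fderiv ℝ φ.1 p (1, 0) * a p + fderiv ℝ φ.1 p (0, 1) * b p)
        = ∫ p in Ω, φ.1 p * h p := by
    have hφ : IsTestFunction Ω φ.1 := φ.2
    simp only [hfderiv]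
    rw [setIntegral_eq_integral_of_forall_compl_eq_zero fun p hp => by
        rw [hφ.fderiv_eq_zero hp, zero_apply],
      setIntegral_eq_integral_of_forall_compl_eq_zero fun p hp => by
        rw [hφ.eq_zero hp, zero_mul]]
    rfl
  rw [LinearMap.ext_iff]
  exact ⟨fun H φ => (hiff φ).2 (H φ.1 φ.2), fun H φ hφ => (hiff ⟨φ, hφ⟩).1 (H ⟨φ, hφ⟩)⟩

namespace IsEntropyPair

variable {f η q : ℝ → ℝ}

lemma continuousOn_pair_comp (h : IsEntropyPair f η q) {Ω : Set (ℝ × ℝ)} {u : ℝ × ℝ → ℝ}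
    (hu : ContinuousOn u Ω) : ContinuousOn (fun p => (η (u p), q (u p))) Ω :=
  (h.entropy_smooth.continuous.prodMk h.flux_smooth.continuous).comp_continuousOn hu

lemma id (hf : ContDiff ℝ 1 f) : IsEntropyPair f (fun z => z) f :=
  ⟨contDiff_id, hf, fun z => by simp⟩

lemma deriv_sub_const_mul_id (h : IsEntropyPair f η q) (r z : ℝ) :
    deriv (fun z => η z - r * z) z = deriv η z - r := by
  simpa only [mul_one] using ((h.entropy_smooth.differentiable one_ne_zero z).hasDerivAt.fun_sub
    ((hasDerivAt_id' z).const_mul r)).deriv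

lemma sub_const_mul_id (h : IsEntropyPair f η q) (hf : ContDiff ℝ 1 f) (r : ℝ) :
    IsEntropyPair f (fun z => η z - r * z) (fun z => q z - r * f z) where
  entropy_smooth := h.entropy_smooth.sub (contDiff_const.mul contDiff_id)
  flux_smooth := h.flux_smooth.sub (contDiff_const.mul hf)
  deriv_flux z := by
    rw [h.deriv_sub_const_mul_id, sub_mul, ← h.deriv_flux]
    exact ((h.flux_smooth.differentiable one_ne_zero z).hasDerivAt.sub
      ((hf.differentiable one_ne_zero z).hasDerivAt.const_mul r)).deriv

lemma defect_eq_defect_sub_const_mul_id (h : IsEntropyPair f η q) (hf : ContDiff ℝ 1 f)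
    {Ω : Set (ℝ × ℝ)} {u g : ℝ × ℝ → ℝ} (hu : ContinuousOn u Ω)
    (hbal : DistribBalance Ω u (fun p => f (u p)) g) (hg : LocallyIntegrableOn g Ω)
    (hg' : LocallyIntegrableOn (fun p => deriv η (u p) * g p) Ω) (r : ℝ) (φ : testFunctions Ω) :
    distribDivergence volume (h.continuousOn_pair_comp hu) φ - distribOfFun hg' φ
      = -(∫ x, fderiv ℝ φ.1 x (η (u x) - r * u x, q (u x) - r * f (u x)))
        - ∫ x, φ.1 x * ((deriv η (u x) - r) * g x) := by
  have hφ : IsTestFunction Ω φ.1 := φ.2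
  have hF := (IsEntropyPair.id hf).continuousOn_pair_comp hu
  have hbal' : -∫ x, fderiv ℝ φ.1 x (u x, f (u x)) = ∫ x, φ.1 x * g x :=
    LinearMap.congr_fun ((distribBalance_iff hF hg).1 hbal) φ
  have hdiv : ∫ x, fderiv ℝ φ.1 x (η (u x) - r * u x, q (u x) - r * f (u x))
      = (∫ x, fderiv ℝ φ.1 x (η (u x), q (u x))) - r * ∫ x, fderiv ℝ φ.1 x (u x, f (u x)) := by
    rw [← integral_const_mul, ← integral_sub
      (hφ.integrable_fderiv_apply (h.continuousOn_pair_comp hu))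
      ((hφ.integrable_fderiv_apply hF).const_mul r)]
    congr with x
    rw [← smul_eq_mul r (fderiv _ _ _ _), ← map_smul, ← map_sub]
    rfl
  have hsource : ∫ x, φ.1 x * ((deriv η (u x) - r) * g x)
      = (∫ x, φ.1 x * (deriv η (u x) * g x)) - r * ∫ x, φ.1 x * g x := by
    rw [← integral_const_mul, ← integral_sub (hφ.integrable_mul hg')
      ((hφ.integrable_mul hg).const_mul r)]
    congr with x
    ring
  rw [hdiv, hsource, ← hbal']
  change -(∫ x, fderiv ℝ φ.1 x (η (u x), q (u x))) - ∫ x, φ.1 x * (deriv η (u x) * g x) = _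
  ring

end IsEntropyPair

namespace IsLagrangianSolution

variable {f η q : ℝ → ℝ} {Ω : Set (ℝ × ℝ)} {u gL gE : ℝ × ℝ → ℝ} {χ : ℝ → ℝ → ℝ} {G : ℝ≥0}

lemma exists_source (hu : IsLagrangianSolution f Ω u χ gL) (hf : ContDiff ℝ 1 f)
    (hΩ : IsOpen Ω) (hΩ_sub : Ω ⊆ halfPlane) (hG : LagrangianSourceBound Ω χ gL G) :
    ∃ gE : ℝ × ℝ → ℝ, LocallyIntegrable gE ∧ (∀ᵐ p ∂(volume.restrict Ω), |gE p| ≤ G) ∧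
      DistribBalance Ω u (fun p => f (u p)) gE := by
  have hid := IsEntropyPair.id hf
  obtain ⟨gE, hloc, hbound, hgE⟩ := exists_eq_integral_of_abs_le (μ := volume) hΩ
    (distribDivergence volume (hid.continuousOn_pair_comp hu.continuousOn)) <|
    abs_le_of_locally_abs_le volume fun p hp => by
      obtain ⟨V, hV, hVle⟩ :=
        hu.exists_nhds_abs_integral_le hf hΩ hΩ_sub hG hp Filter.univ_mem
      refine ⟨V, hV, fun φ hφ => (abs_neg _).trans_le ?_⟩
      simpa using hVle (c := 1) hid (by simp) φ.1 hφ
  exact ⟨gE, hloc, hbound, (distribBalance_iff _ (hloc.locallyIntegrableOn Ω)).2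
    (LinearMap.ext hgE)⟩

/-- Near `p` the entropy `η` is compared with the linear entropy of slope `η'(u p)`, for which
there is no defect: the difference of the two has small derivative. -/
lemma exists_nhds_abs_entropyDefect_le (hu : IsLagrangianSolution f Ω u χ gL)
    (hf : ContDiff ℝ 1 f) (hΩ : IsOpen Ω) (hΩ_sub : Ω ⊆ halfPlane)
    (hG : LagrangianSourceBound Ω χ gL G) (hloc : LocallyIntegrableOn gE Ω)
    (hbound : ∀ᵐ p ∂(volume.restrict Ω), |gE p| ≤ G)
    (hbal : DistribBalance Ω u (fun p => f (u p)) gE) (h : IsEntropyPair f η q)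
    (hloc' : LocallyIntegrableOn (fun p => deriv η (u p) * gE p) Ω)
    {p : ℝ × ℝ} (hp : p ∈ Ω) {ε : ℝ} (hε : 0 < ε) :
    ∃ V ∈ 𝓝 p, ∀ φ : testFunctions Ω, IsTestFunction V φ.1 →
      |distribDivergence volume (h.continuousOn_pair_comp hu.continuousOn) φ
        - distribOfFun hloc' φ| ≤ ε * (2 * G) * ∫ x, |φ.1 x| := by
  set r := deriv η (u p)
  lift ε to ℝ≥0 using hε.le
  set N := {x | |deriv η (u x) - r| ≤ ε} ∩ Ω
  have hN : N ∈ 𝓝 p := by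
    have hcont : ContinuousAt (fun x => deriv η (u x)) p :=
      (h.entropy_smooth.continuous_deriv le_rfl).continuousAt.comp
        (hu.continuousOn.continuousAt (hΩ.mem_nhds hp))
    exact Filter.inter_mem (hcont.eventually (Metric.closedBall_mem_nhds _ hε)) (hΩ.mem_nhds hp)
  obtain ⟨V, hV, hVle⟩ := hu.exists_nhds_abs_integral_le hf hΩ hΩ_sub hG hp hN
  refine ⟨V ∩ N, Filter.inter_mem hV hN, fun φ hφ => ?_⟩
  have hdiv : |∫ x, fderiv ℝ φ.1 x (η (u x) - r * u x, q (u x) - r * f (u x))|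
      ≤ ε * G * ∫ x, |φ.1 x| :=
    hVle (h.sub_const_mul_id hf r) (fun x hx => by rw [h.deriv_sub_const_mul_id]; exact hx.1) _
      (hφ.mono inter_subset_left)
  have hsource : |∫ x, φ.1 x * ((deriv η (u x) - r) * gE x)| ≤ ε * G * ∫ x, |φ.1 x| := by
    refine hφ.abs_integral_mul_le ?_
    filter_upwards [(ae_restrict_iff' hΩ.measurableSet).1 hbound] with x hx hxV
    rw [abs_mul]
    exact mul_le_mul hxV.2.1 (hx hxV.2.2) (abs_nonneg _) ε.2
  rw [h.defect_eq_defect_sub_const_mul_id hf hu.continuousOn hbal hloc hloc' r φ]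
  refine (abs_sub _ _).trans ?_
  rw [abs_neg]
  linarith

lemma entropy_balance (hu : IsLagrangianSolution f Ω u χ gL) (hf : ContDiff ℝ 1 f)
    (hΩ : IsOpen Ω) (hΩ_sub : Ω ⊆ halfPlane) (hG : LagrangianSourceBound Ω χ gL G)
    (hloc : LocallyIntegrableOn gE Ω) (hbound : ∀ᵐ p ∂(volume.restrict Ω), |gE p| ≤ G)
    (hbal : DistribBalance Ω u (fun p => f (u p)) gE) (h : IsEntropyPair f η q) :
    DistribBalance Ω (fun p => η (u p)) (fun p => q (u p)) (fun p => deriv η (u p) * gE p) := by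
  have hη : ContinuousOn (fun p => deriv η (u p)) Ω :=
    (h.entropy_smooth.continuous_deriv le_rfl).comp_continuousOn hu.continuousOn
  have hloc' := hloc.continuousOn_mul hη hΩ.isLocallyClosed
  have hF := h.continuousOn_pair_comp hu.continuousOn
  rw [distribBalance_iff hF hloc']
  ext φ
  refine sub_eq_zero.1 (abs_nonpos_iff.1 (le_of_forall_pos_le_add_mul
    (z := 2 * G * ∫ x, |φ.1 x|) fun ε hε => ?_))
  have hglobal := abs_le_of_locally_abs_le (L := distribDivergence volume hF - distribOfFun hloc')
    volume (fun p hp => hu.exists_nhds_abs_entropyDefect_le hf hΩ hΩ_sub hG hloc hbound hbal h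
      hloc' hp hε) φ
  rwa [zero_add, ← mul_assoc]

lemma sourceBound_nonneg {G : ℝ} (hu : IsLagrangianSolution f Ω u χ gL) (hΩ : IsOpen Ω)
    (hΩ_sub : Ω ⊆ halfPlane) (hne : Ω.Nonempty) (hG : LagrangianSourceBound Ω χ gL G) :
    0 ≤ G := by
  obtain ⟨⟨t, x⟩, hp⟩ := hne
  obtain ⟨y, rfl⟩ := hu.param.surjective t (hΩ_sub hp).1 x
  have hT : volume (curveTimes Ω fun s => χ s y) ≠ 0 :=
    ((hu.param.isOpen_curveTimes hΩ hΩ_sub y).measure_pos volume ⟨t, hp⟩).ne'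
  have : (ae (volume.restrict (curveTimes Ω fun s => χ s y))).NeBot :=
    ae_neBot.2 (Measure.restrict_eq_zero.not.2 hT)
  obtain ⟨s, hs⟩ := (hG y).exists
  exact (abs_nonneg _).trans hs

end IsLagrangianSolution

theorem corollaryC_general (f : ℝ → ℝ) (hf : ContDiff ℝ 1 f)
    (Ω : Set (ℝ × ℝ)) (hΩ : IsOpen Ω) (hΩ_sub : Ω ⊆ halfPlane)
    (u : ℝ × ℝ → ℝ) (χ : ℝ → ℝ → ℝ) (gL : ℝ × ℝ → ℝ)
    (hu : IsLagrangianSolution f Ω u χ gL)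
    (G : ℝ) (hG : LagrangianSourceBound Ω χ gL G) :
    ∃ gE : ℝ × ℝ → ℝ,
      IsEulerianSolution f Ω u gE ∧
      (∀ᵐ p ∂(volume.restrict Ω), |gE p| ≤ G) ∧
      ∀ η q : ℝ → ℝ, IsEntropyPair f η q →
        DistribBalance Ω (fun p => η (u p)) (fun p => q (u p))
          (fun p => deriv η (u p) * gE p) := by
  rcases Ω.eq_empty_or_nonempty with rfl | hne
  · exact ⟨0, ⟨hu.continuousOn, by simp, fun φ _ => by simp⟩, by simp, fun η q _ φ _ => by simp⟩
  lift G to ℝ≥0 using hu.sourceBound_nonneg hΩ hΩ_sub hne hG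
  obtain ⟨gE, hloc, hbound, hbal⟩ := hu.exists_source hf hΩ hΩ_sub hG
  have hmemLp : MemLp gE ⊤ (volume.restrict Ω) :=
    memLp_top_of_bound hloc.aestronglyMeasurable.restrict G hbound
  exact ⟨gE, ⟨hu.continuousOn, hmemLp, hbal⟩, hbound, fun η q h =>
    hu.entropy_balance hf hΩ hΩ_sub hG (hloc.locallyIntegrableOn Ω) hbound hbal h⟩

theorem corollaryC (f : ℝ → ℝ) (hf : ContDiff ℝ 2 f)
    (Ω : Set (ℝ × ℝ)) (hΩ : IsOpen Ω) (hΩ_sub : Ω ⊆ halfPlane)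
    (u : ℝ × ℝ → ℝ) (χ : ℝ → ℝ → ℝ) (gL : ℝ × ℝ → ℝ)
    (hu : IsLagrangianSolution f Ω u χ gL)
    (G : ℝ) (hG : LagrangianSourceBound Ω χ gL G) :
    ∃ gE : ℝ × ℝ → ℝ,
      IsEulerianSolution f Ω u gE ∧
      (∀ᵐ p ∂(volume.restrict Ω), |gE p| ≤ G) ∧
      ∀ η q : ℝ → ℝ, IsEntropyPair f η q →
        DistribBalance Ω (fun p => η (u p)) (fun p => q (u p))
          (fun p => deriv η (u p) * gE p) :=
  corollaryC_general f (hf.of_le (by norm_num)) Ω hΩ hΩ_sub u χ gL hu G hG
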